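/- All graphs are finite and simple. For a graph $G$, let $\rho(G)$ denote its spectral radius, i.e. the largest eigenvalue of its adjacency matrix. A $k$-factor of $G$ is a $k$-regular spanning subgraph of $G$. For an integer $l$, the $l$-closure $C_l(G)$ is the graph obtained from $G$ by successively joining pairs of nonadjacent vertices whose degree sum is at least $l$ until no such pair exists (the result does not depend on the order). $K_m$ is the complete graph on $m$ vertices, $I_m$ is the graph with $m$ vertices and no edges, $G_1+G_2$ is the disjoint union, and $G_1\vee G_2$ is the join, i.e. $G_1+G_2$ together with all edges between $V(G_1)$ and $V(G_2)$. Let $\delta$ be a nonnegative integer and let $G$ be a graph of order $n$ with minimum degree at least $\delta$. (i) Suppose that $n$ is even, $1\le\delta\le\frac n2-1$, $n\ge 6\delta+10$ and $$\rho(G)>\frac{\delta-1}{2}+\sqrt{n^{2}-(3\delta+5)n+\frac{13\delta^{2}+23\delta+41}{4}}.$$ Then $G$ has a $1$-factor, unless either $\delta$ is even and $C_{n-1}(G)\cong K_{n-\delta-1}+K_{\delta+1}$, or $C_{n-1}(G)\cong K_{\delta}\vee(K_{n-2\delta-1}+I_{\delta+1})$. (ii) Let $k\ge 2$ be an integer with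 $nk$ even, and suppose that $2k-2\le\delta\le\left\lfloor\frac{n+2k-5}{2}\right\rfloor$, $n\ge 6\delta+4k-3$ and $$\rho(G)>\frac{\delta-1}{2}+\sqrt{n^{2}-(3\delta-4k+11)n+\frac{13\delta^{2}-(32k-94)\delta+16k^{2}-104k+161}{4}}.$$ Then $G$ has a $k$-factor. -/

import Mathlib

namespace FactorSpectral

/-- The largest eigenvalue of the adjacency matrix of a finite graph
(junk value `0` only for the graph without vertices). -/
noncomputable def spectralRadius {V : Type*} [Fintype V] [DecidableEq V] (G : SimpleGraph V)
    [DecidableRel G.Adj] : ℝ :=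
  sSup {μ : ℝ | Module.End.HasEigenvalue (Matrix.toLin' (G.adjMatrix ℝ)) μ}

open Classical in
/-- `G` has a `k`-factor: a `k`-regular spanning subgraph. -/
def HasFactor {V : Type*} [Fintype V] (G : SimpleGraph V) (k : ℕ) : Prop :=
  ∃ F : SimpleGraph V, F ≤ G ∧ F.IsRegularOfDegree k

/-- The join of two vertex-disjoint graphs: the disjoint union together with all edges between
the two parts. -/
def join {V W : Type*} (G : SimpleGraph V) (H : SimpleGraph W) : SimpleGraph (V ⊕ W) :=
  (G ⊕g H) ⊔ completeBipartiteGraph V W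

open Classical in
/-- One step of the `l`-closure process: `H` arises from `G` by joining two distinct nonadjacent
vertices whose degree sum in `G` is at least `l`. -/
def ClosureStep {V : Type*} [Fintype V] (l : ℕ) (G H : SimpleGraph V) : Prop :=
  ∃ u v : V, u ≠ v ∧ ¬ G.Adj u v ∧ l ≤ G.degree u + G.degree v ∧ H = G ⊔ SimpleGraph.edge u v

/-- `H` is the end result of a run of the `l`-closure process started at `G`: it is reached by
finitely many steps, and no further step is possible. -/
def IsClosure {V : Type*} [Fintype V] (l : ℕ) (G H : SimpleGraph V) : Prop :=
  Relation.ReflTransGen (ClosureStep l) G H ∧ ∀ K, ¬ ClosureStep l H K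

theorem ClosureStep.lt {V : Type*} [Fintype V] {l : ℕ} {G H : SimpleGraph V}
    (h : ClosureStep l G H) : G < H := by
  obtain ⟨u, v, huv, hn, -, rfl⟩ := h
  refine lt_of_le_of_ne le_sup_left fun he => hn ?_
  rw [he]
  exact Or.inr (by simp [SimpleGraph.edge_adj, huv])

theorem exists_isClosure {V : Type*} [Fintype V] (l : ℕ) (G : SimpleGraph V) :
    ∃ H, IsClosure l G H := by
  induction G using (wellFounded_gt (α := SimpleGraph V)).induction with
  | _ G ih =>
    by_cases h : ∃ K, ClosureStep l G K
    · obtain ⟨K, hK⟩ := h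
      obtain ⟨H, hH, hc⟩ := ih K hK.lt
      exact ⟨H, Relation.ReflTransGen.head hK hH, hc⟩
    · exact ⟨G, Relation.ReflTransGen.refl, fun K hK => h ⟨K, hK⟩⟩

/-- Every graph reached from `G` lies below every graph above `G` that admits no further step. -/
theorem le_of_reflTransGen {V : Type*} [Fintype V] {l : ℕ} {G H K : SimpleGraph V}
    (h : Relation.ReflTransGen (ClosureStep l) G H) (hGK : G ≤ K)
    (hK : ∀ K', ¬ ClosureStep l K K') : H ≤ K := by
  classical
  induction h with
  | refl => exact hGK
  | tail _ hs ih =>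
    obtain ⟨u, v, huv, -, hd, rfl⟩ := hs
    refine sup_le ih ?_
    have hadj : K.Adj u v := by
      by_contra hn
      refine hK _ ⟨u, v, huv, hn, hd.trans (add_le_add ?_ ?_), rfl⟩ <;>
        exact SimpleGraph.degree_le_of_le ih
    exact (SimpleGraph.edge_le_iff (G := K)).2 (Or.inr hadj)

/-- The outcome of the closure process does not depend on the order of the steps. -/
theorem IsClosure.unique {V : Type*} [Fintype V] {l : ℕ} {G H K : SimpleGraph V}
    (hH : IsClosure l G H) (hK : IsClosure l G K) : H = K := by
  have le : ∀ {A : SimpleGraph V}, Relation.ReflTransGen (ClosureStep l) G A → G ≤ A := by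
    intro A hA
    induction hA with
    | refl => exact le_rfl
    | tail _ hs ih => exact ih.trans hs.lt.le
  exact le_antisymm (le_of_reflTransGen hH.1 (le hK.1) hK.2)
    (le_of_reflTransGen hK.1 (le hH.1) hH.2)

/-- The `l`-closure `C_l(G)`: the graph obtained from `G` by successively joining pairs of
nonadjacent vertices whose degree sum is at least `l` until no such pair exists. -/
noncomputable def closure {V : Type*} [Fintype V] (l : ℕ) (G : SimpleGraph V) : SimpleGraph V :=
  (exists_isClosure l G).choose

theorem closure_spec {V : Type*} [Fintype V] (l : ℕ) (G : SimpleGraph V) :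
    IsClosure l G (closure l G) :=
  (exists_isClosure l G).choose_spec

end FactorSpectral

/-! Put `l = n - 1` and `t = δ + 1` if `k = 1`, and `l = n + 2k - 4` and `t = δ + 4 - 2k` if `k ≥
2`. A `k`-factor of the `l`-closure `H` of `G` can be pulled back to `G`
(`HasFactor.of_reflTransGen`), so only `H` has to be studied.

In `H` any two vertices of degree at least `l / 2` are adjacent, so the set `B` of the remaining
vertices has a clique as complement. If `#B > t`, there is a set of `b > t` vertices with `2b + l ≤
2n`, all of degree at most `b + l - n` in `H`. A nonnegative vector `x` with `ρ(G) x ≤ A(H) x` then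
yields an inequality between `ρ(G)`, `n` and `b` (`subeigenvector_bound`) that the assumption on
`ρ(G)` refutes for every such `b` (`spectral_estimate_matching`, `spectral_estimate_factor`). Hence
`#B ≤ t`.

Counting degrees, a nonadjacent pair `b ∈ B`, `w ∉ B` forces `#B = t` and degree `δ` on all of `B`;
moreover each vertex outside `B` sees all of `B` or none of it. Without such a pair `H` is complete.
With one, the closure of `H + bw` is complete, so `H + bw` has a `k`-factor; either it avoids `bw`,
or removing `bw` leaves a subgraph of `H` that is deficient only at `b` and `w`. Exchanging edges
moves the deficiency from `b` into the clique, where there is room to repair it. This always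
succeeds for `k ≥ 2`. For `k = 1` it fails only if `B` is independent, or is a complete component of
odd order `δ + 1`; these are the two exceptional closures. -/

namespace FactorSpectral
open Finset
-- Spectral radius against a set of vertices of small degree.
section Spectral

/-- Take absolute values of an eigenvector for the largest eigenvalue. The inequality is all that is
needed, so Perron–Frobenius is avoided. If the set of eigenvalues were empty, its `sSup` would be
`0` and the constant vector would do. -/
theorem exists_subeigenvector {V : Type*} [Fintype V] [DecidableEq V] [Nonempty V]
    (G : SimpleGraph V) [DecidableRel G.Adj] :
    ∃ x : V → ℝ, (∀ v, 0 ≤ x v) ∧ x ≠ 0 ∧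
      ∀ v, spectralRadius G * x v ≤ ∑ u ∈ G.neighborFinset v, x u := by
  unfold spectralRadius
  set s := {μ : ℝ | Module.End.HasEigenvalue (Matrix.toLin' (G.adjMatrix ℝ)) μ} with hs
  rcases s.eq_empty_or_nonempty with he | hne
  · refine ⟨fun _ => 1, fun _ => zero_le_one, fun h => ?_, fun v => ?_⟩
    · have := congrFun h (Classical.arbitrary V)
      simp at this
    · rw [he, Real.sSup_empty]
      simp
  · have hfin : s.Finite := Module.End.finite_hasEigenvalue _
    have hmem : sSup s ∈ s := hne.csSup_mem hfin
    obtain ⟨z, hz⟩ := Module.End.HasEigenvalue.exists_hasEigenvector hmem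
    refine ⟨fun v => |z v|, fun v => abs_nonneg _, fun h => hz.2 ?_, fun v => ?_⟩
    · funext v
      simpa using congrFun h v
    · have h1 := congrFun hz.apply_eq_smul v
      rw [Matrix.toLin'_apply, SimpleGraph.adjMatrix_mulVec_apply] at h1
      calc sSup s * |z v| ≤ |sSup s| * |z v| := by gcongr; exact le_abs_self _
        _ = |∑ u ∈ G.neighborFinset v, z u| := by rw [h1]; simp [abs_mul]
        _ ≤ _ := Finset.abs_sum_le_sum_abs _ _

-- Two quantities control `x`: its maximum `M` on `B` and its sum `p` off `B`. Summing the
-- inequality over the complement of `B` bounds `p` by a multiple of `M`; evaluating it at a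
-- maximiser in `B` bounds `M` by a multiple of `p`. Multiplying the two bounds and cancelling `p >
-- 0` gives the claim.
open Classical in
theorem subeigenvector_bound {V : Type*} [Fintype V] (H : SimpleGraph V) {x : V → ℝ} {ρ : ℝ}
    (hx : ∀ v, 0 ≤ x v) (hx0 : x ≠ 0) (hsub : ∀ v, ρ * x v ≤ ∑ u ∈ H.neighborFinset v, x u)
    {B : Finset V} {e : ℕ} (hB : ∀ v ∈ B, H.degree v ≤ e) (hne : B.Nonempty) (he : (e : ℝ) < ρ)
    (hpos : 0 < ρ * (ρ + 1) - e * #B) :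
    (ρ + 1 - Fintype.card V + #B) * (ρ * (ρ + 1) - e * #B) ≤ #B * (e : ℝ) ^ 2 := by
  have he0 : (0 : ℝ) ≤ e := Nat.cast_nonneg e
  have hρ : 0 < ρ := he0.trans_lt he
  obtain ⟨m, hmB, hm⟩ := B.exists_max_image x hne
  set M := x m with hM
  have hM0 : 0 ≤ M := hx m
  set p := ∑ w ∈ Bᶜ, x w with hp
  have hp0 : 0 ≤ p := Finset.sum_nonneg fun w _ => hx w
  have hbM : ∀ s ⊆ B, ∑ v ∈ s, x v ≤ #B * M := fun s hs =>
    (Finset.sum_le_card_nsmul s x M fun v hv => hm v (hs hv)).trans (by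
      rw [nsmul_eq_mul]
      have := Finset.card_le_card hs
      gcongr)
  have hsplit : ∀ w ∈ Bᶜ, (ρ + 1) * x w ≤ p + ∑ v ∈ B with H.Adj w v, x v := by
    intro w hw
    have h1 : ∑ u ∈ H.neighborFinset w, x u =
        ∑ u ∈ Bᶜ with H.Adj w u, x u + ∑ v ∈ B with H.Adj w v, x v := by
      rw [SimpleGraph.neighborFinset_eq_filter, ← Finset.sum_union]
      · congr 1
        ext u
        simp only [mem_filter, mem_univ, true_and, mem_union, mem_compl]
        tauto
      · rw [Finset.disjoint_left]
        intro u
        simp only [mem_filter, mem_compl]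
        tauto
    have h2 : ∑ u ∈ Bᶜ with H.Adj w u, x u ≤ p - x w := by
      rw [hp, ← Finset.sum_erase_eq_sub hw]
      refine Finset.sum_le_sum_of_subset_of_nonneg (fun u hu => ?_) fun u _ _ => hx u
      rw [mem_filter] at hu
      exact mem_erase.2 ⟨hu.2.ne', hu.1⟩
    have := hsub w
    linarith
  have hK : ∀ w ∈ Bᶜ, x w ≤ (p + #B * M) / (ρ + 1) := by
    intro w hw
    rw [le_div_iff₀ (by linarith), mul_comm]
    have := hbM _ (B.filter_subset fun v => H.Adj w v)
    linarith [hsplit w hw]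
  have hall : ∀ T : ℝ, M ≤ T → (p + #B * M) / (ρ + 1) ≤ T → ρ * M ≤ e * T := by
    intro T h1 h2
    refine (hsub m).trans ((Finset.sum_le_card_nsmul _ x T fun u _ => ?_).trans ?_)
    · by_cases hu : u ∈ B
      · exact (hm u hu).trans h1
      · exact (hK u (mem_compl.2 hu)).trans h2
    · rw [nsmul_eq_mul, SimpleGraph.card_neighborFinset_eq_degree]
      have : 0 ≤ T := hM0.trans h1
      have := hB m hmB
      gcongr
  have hzero : ¬ (p = 0 ∧ M = 0) := by
    rintro ⟨h1, h2⟩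
    refine hx0 (funext fun v => ?_)
    by_cases hv : v ∈ B
    · exact le_antisymm ((hm v hv).trans h2.le) (hx v)
    · exact (Finset.sum_eq_zero_iff_of_nonneg fun w _ => hx w).1 h1 v (mem_compl.2 hv)
  -- `T` is the larger of the bounds for `x` on `B` and off `B`. If that is `M`, then `ρ * M ≤ e *
  -- M` with `e < ρ` forces `M = 0`.
  have hMp : M * (ρ * (ρ + 1) - e * #B) ≤ e * p := by
    rcases le_total ((p + #B * M) / (ρ + 1)) M with h | h
    · have h1 := hall M le_rfl h
      have h2 : M = 0 := by nlinarith
      rw [h2]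
      simp only [zero_mul]
      positivity
    · have h1 := hall _ h le_rfl
      rw [← mul_div_assoc, le_div_iff₀ (by linarith)] at h1
      linarith
  have hppos : 0 < p := by
    refine lt_of_le_of_ne hp0 fun h => hzero ⟨h.symm, ?_⟩
    rw [← h, mul_zero] at hMp
    exact le_antisymm (nonpos_of_mul_nonpos_left hMp hpos) hM0
  -- Each vertex of `B` is counted at most `e` times, by its degree.
  have hcross : ∑ w ∈ Bᶜ, ∑ v ∈ B with H.Adj w v, x v ≤ #B * (e * M) := by
    simp_rw [Finset.sum_filter]
    rw [Finset.sum_comm, ← nsmul_eq_mul]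
    refine Finset.sum_le_card_nsmul _ _ _ fun v hv => ?_
    rw [← Finset.sum_filter, Finset.sum_const, nsmul_eq_mul]
    have h1 : #{w ∈ Bᶜ | H.Adj w v} ≤ e := by
      refine le_trans ?_ (hB v hv)
      rw [← SimpleGraph.card_neighborFinset_eq_degree]
      refine Finset.card_le_card fun w hw => ?_
      rw [mem_filter] at hw
      exact (SimpleGraph.mem_neighborFinset _ _ _).2 hw.2.symm
    have := hm v hv
    have := hx v
    gcongr
  have hsum : (ρ + 1) * p ≤ (Fintype.card V - #B) * p + #B * (e * M) := by
    have h1 := Finset.sum_le_sum hsplit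
    rw [← Finset.mul_sum, Finset.sum_add_distrib, Finset.sum_const, nsmul_eq_mul,
      Finset.card_compl, Nat.cast_sub (Finset.card_le_univ B)] at h1
    linarith
  have h3 : (ρ + 1 - Fintype.card V + #B) * p ≤ #B * e * M := by linarith
  have h4 := mul_le_mul_of_nonneg_right h3 hpos.le
  have h5 := mul_le_mul_of_nonneg_left hMp (show (0 : ℝ) ≤ #B * e by positivity)
  refine le_of_mul_le_mul_right ?_ hppos
  nlinarith

end Spectral
-- Edge exchanges in near factors and stability of `k`-factors under closure.
section Exchange
open Classical

variable {V : Type*}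

theorem sdiff_edge_sup_edge (F : SimpleGraph V) {a b : V} (h : F.Adj a b) :
    (F \ SimpleGraph.edge a b) ⊔ SimpleGraph.edge a b = F := by
  rw [sdiff_sup_self, sup_eq_left, SimpleGraph.edge_le_iff]
  exact Or.inr h

theorem not_sdiff_edge_adj (F : SimpleGraph V) {a b : V} (hab : a ≠ b) :
    ¬ (F \ SimpleGraph.edge a b).Adj a b := by
  rw [SimpleGraph.sdiff_adj, SimpleGraph.edge_adj]
  tauto

/-- The exchange of `x y` for `u x`. -/
def exchange (F : SimpleGraph V) (u x y : V) : SimpleGraph V :=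
  (F \ SimpleGraph.edge x y) ⊔ SimpleGraph.edge u x

theorem exchange_adj_iff {F : SimpleGraph V} {u x y : V} (hux : u ≠ x) (hxy : x ≠ y) {a b : V} :
    (exchange F u x y).Adj a b ↔ (F.Adj a b ∧ ¬ (a = x ∧ b = y ∨ a = y ∧ b = x)) ∨
      (a = u ∧ b = x ∨ a = x ∧ b = u) := by
  rw [exchange, SimpleGraph.sup_adj, SimpleGraph.sdiff_adj, SimpleGraph.edge_adj,
    SimpleGraph.edge_adj]
  grind

variable [Fintype V]

/-- The neighbours of a vertex, as a finset. -/
noncomputable def nbr (F : SimpleGraph V) (z : V) : Finset V := univ.filter (F.Adj z)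

/-- The degree of a vertex, as the cardinality of `nbr`. -/
noncomputable def deg (F : SimpleGraph V) (z : V) : ℕ := #(nbr F z)

@[simp]
theorem mem_nbr {F : SimpleGraph V} {z y : V} : y ∈ nbr F z ↔ F.Adj z y := by
  simp [nbr]

theorem degree_eq_deg (F : SimpleGraph V) (z : V) [Fintype (F.neighborSet z)] :
    F.degree z = deg F z := by
  rw [deg, ← SimpleGraph.card_neighborFinset_eq_degree]
  congr 1
  ext y
  simp

theorem degree_sup_edge (F : SimpleGraph V) {a b : V} (hab : a ≠ b) (h : ¬ F.Adj a b) (z : V) :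
    deg (F ⊔ SimpleGraph.edge a b) z =
      deg F z + (if z = a then 1 else 0) + (if z = b then 1 else 0) := by
  have hadj : ∀ y, (F ⊔ SimpleGraph.edge a b).Adj z y ↔
      F.Adj z y ∨ (z = a ∧ y = b) ∨ (z = b ∧ y = a) := by
    intro y
    rw [SimpleGraph.sup_adj, SimpleGraph.edge_adj]
    constructor
    · rintro (h | ⟨h | h, -⟩)
      · exact Or.inl h
      · exact Or.inr (Or.inl ⟨h.1.symm ▸ rfl, h.2.symm ▸ rfl⟩)
      · exact Or.inr (Or.inr ⟨h.1.symm ▸ rfl, h.2.symm ▸ rfl⟩)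
    · rintro (h | ⟨rfl, rfl⟩ | ⟨rfl, rfl⟩)
      · exact Or.inl h
      · exact Or.inr ⟨by tauto, hab⟩
      · exact Or.inr ⟨by tauto, hab.symm⟩
  simp only [deg]
  have hN : ∀ s : Finset V, (∀ y, y ∈ s ↔ F.Adj z y ∨ (z = a ∧ y = b) ∨ (z = b ∧ y = a)) →
      #(nbr (F ⊔ SimpleGraph.edge a b) z) = #s := by
    intro s hs
    congr 1
    ext y
    rw [mem_nbr, hadj, hs]
  by_cases h1 : z = a
  · subst h1
    rw [hN (insert b (nbr F z)), card_insert_of_notMem (by simpa using h)]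
    · simp [hab]
    · intro y
      simp only [mem_insert, mem_nbr]
      tauto
  · by_cases h2 : z = b
    · subst h2
      rw [hN (insert a (nbr F z)),
        card_insert_of_notMem (by simpa [F.adj_comm] using h)]
      · simp [h1]
      · intro y
        simp only [mem_insert, mem_nbr]
        tauto
    · rw [hN (nbr F z)]
      · simp [h1, h2]
      · intro y
        simp only [mem_nbr]
        tauto

theorem degree_sdiff_edge (F : SimpleGraph V) {a b : V} (h : F.Adj a b) (z : V) :
    deg (F \ SimpleGraph.edge a b) z + (if z = a then 1 else 0) + (if z = b then 1 else 0) =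
      deg F z := by
  rw [← degree_sup_edge _ h.ne (not_sdiff_edge_adj F h.ne), sdiff_edge_sup_edge F h]

/-- `F` is a subgraph of `H` all of whose degrees are `k`, except that each of `u`, `v` lacks one
edge (two if `u = v`). -/
def NearFactor (H F : SimpleGraph V) (k : ℕ) (u v : V) : Prop :=
  F ≤ H ∧ ∀ z, deg F z + (if z = u then 1 else 0) + (if z = v then 1 else 0) = k

variable {H F : SimpleGraph V} {k : ℕ} {u v x y : V}

theorem NearFactor.symm (h : NearFactor H F k u v) : NearFactor H F k v u :=
  ⟨h.1, fun z => by rw [← h.2 z]; ring⟩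

theorem NearFactor.degree_eq (h : NearFactor H F k u v) {z : V} (h1 : z ≠ u) (h2 : z ≠ v) :
    deg F z = k := by
  simpa [h1, h2] using h.2 z

theorem NearFactor.degree_le (h : NearFactor H F k u v) (z : V) : deg F z ≤ k := by
  have := h.2 z
  omega

theorem NearFactor.degree_left (h : NearFactor H F k u v) (huv : u ≠ v) :
    deg F u + 1 = k := by
  simpa [huv] using h.2 u

theorem NearFactor.hasFactor (h : NearFactor H F k u v) (hH : H.Adj u v) (hF : ¬ F.Adj u v) :
    HasFactor H k := by
  refine ⟨F ⊔ SimpleGraph.edge u v, sup_le h.1 ((SimpleGraph.edge_le_iff (G := H)).2 (Or.inr hH)),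
    fun z => ?_⟩
  rw [degree_eq_deg, ← h.2 z, ← degree_sup_edge F hH.ne hF]

/-- Adding `ux` and deleting `xy` leaves the degree of `x` unchanged, so the deficiency travels from
`u` to `y`. The case `y = v` is allowed and makes `v` doubly deficient. -/
theorem NearFactor.move (h : NearFactor H F k u v) (hH : H.Adj u x) (hF : ¬ F.Adj u x)
    (hxy : F.Adj x y) : NearFactor H (exchange F u x y) k y v := by
  refine ⟨sup_le (sdiff_le.trans h.1) ((SimpleGraph.edge_le_iff (G := H)).2 (Or.inr hH)),
    fun z => ?_⟩
  have h1 : ¬ (F \ SimpleGraph.edge x y).Adj u x := fun h' => hF (sdiff_le (a := F) h')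
  have h2 := degree_sdiff_edge F hxy z
  have h3 := h.2 z
  have hd : deg (exchange F u x y) z = deg (F \ SimpleGraph.edge x y) z +
      (if z = u then 1 else 0) + (if z = x then 1 else 0) := degree_sup_edge _ hH.ne h1 z
  omega

/-- Double counting of the edges at a set whose neighbours lie in another set. -/
theorem card_le_of_neighbors_subset (hk : 0 < k) {X Z : Finset V}
    (hX : ∀ p ∈ X, deg F p = k) (hZ : ∀ q ∈ Z, deg F q ≤ k)
    (hXZ : ∀ p ∈ X, ∀ q, F.Adj p q → q ∈ Z) :
    #X ≤ #Z ∧ (#X = #Z → ∀ q ∈ Z, ∀ p, F.Adj q p → p ∈ X) := by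
  have h1 : #X * k = ∑ q ∈ Z, #{p ∈ X | F.Adj q p} := by
    rw [← Finset.sum_const_nat hX]
    have : ∀ p ∈ X, deg F p = ∑ q ∈ Z, if F.Adj q p then 1 else 0 := by
      intro p hp
      rw [← Finset.card_filter, deg]
      congr 1
      ext q
      simp only [mem_nbr, mem_filter]
      exact ⟨fun h => ⟨hXZ p hp q h, h.symm⟩, fun h => h.2.symm⟩
    rw [Finset.sum_congr rfl this, Finset.sum_comm]
    simp_rw [← Finset.card_filter]
  have h2 : ∀ q ∈ Z, #{p ∈ X | F.Adj q p} ≤ k := by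
    intro q hq
    refine le_trans ?_ (hZ q hq)
    rw [deg]
    refine Finset.card_le_card fun p hp => ?_
    simpa using (mem_filter.1 hp).2
  have h3 : ∑ q ∈ Z, #{p ∈ X | F.Adj q p} ≤ ∑ _q ∈ Z, k := Finset.sum_le_sum h2
  refine ⟨?_, fun heq q hq p hqp => ?_⟩
  · rw [← h1, Finset.sum_const, smul_eq_mul] at h3
    exact Nat.le_of_mul_le_mul_right h3 hk
  · have h4 : ∑ q ∈ Z, #{p ∈ X | F.Adj q p} = ∑ _q ∈ Z, k := by
      rw [← h1, Finset.sum_const, smul_eq_mul, heq]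
    have h5 := (Finset.sum_eq_sum_iff_of_le h2).1 h4 q hq
    have h6 : ({p ∈ X | F.Adj q p} : Finset V) = nbr F q := by
      refine Finset.eq_of_subset_of_card_le (fun p hp => by simpa using (mem_filter.1 hp).2) ?_
      rw [h5, ← deg]
      exact hZ q hq
    have h7 : p ∈ nbr F q := by simpa using hqp
    rw [← h6] at h7
    exact (mem_filter.1 h7).1

theorem exists_adj_of_degree_pos (h : 0 < deg F x) : ∃ y, F.Adj x y :=
  (Finset.card_pos.1 h).imp fun _ hy => mem_nbr.1 hy

theorem exists_adj_ne_of_one_lt_degree (h : 1 < deg F x) (z : V) : ∃ y, F.Adj x y ∧ y ≠ z := by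
  rw [deg] at h
  obtain ⟨y, hy, hz⟩ := Finset.exists_mem_ne h z
  exact ⟨y, by simpa using hy, hz⟩

theorem card_sdiff_neighborFinset (h : F ≤ H) (u : V) :
    #(nbr H u \ nbr F u) + deg F u = deg H u := by
  exact Finset.card_sdiff_add_card_eq_card fun y hy => by
    simpa using h (by simpa using hy)

/-- Ore-type condition under which a near factor with two nonadjacent deficient vertices can be
completed. -/
theorem NearFactor.hasFactor_of_degree_add (h : NearFactor H F k u v) (huv : u ≠ v)
    (hH : ¬ H.Adj u v) (hd : (Fintype.card V + 2 * k ≤ deg H u + deg H v + 3) ∨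
      (2 ≤ k ∧ Fintype.card V + 2 * k ≤ deg H u + deg H v + 4)) : HasFactor H k := by
  by_contra hno
  have hk : 0 < k := by have := h.degree_left huv; omega
  have hFuv : ¬ F.Adj u v := fun h' => hH (h.1 h')
  set A := nbr H u \ nbr F u with hA
  set B := nbr H v \ nbr F v with hB
  have mA : ∀ z, z ∈ A ↔ H.Adj u z ∧ ¬ F.Adj u z := fun z => by simp [hA]
  have mB : ∀ z, z ∈ B ↔ H.Adj v z ∧ ¬ F.Adj v z := fun z => by simp [hB]
  have cA := card_sdiff_neighborFinset h.1 u
  have cB := card_sdiff_neighborFinset h.1 v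
  rw [← hA] at cA
  rw [← hB] at cB
  have du := h.degree_left huv
  have dv := h.symm.degree_left huv.symm
  -- An edge `xy` of `F` from `A` to `B` could be replaced by `ux` and `yv`.
  have hAB : ∀ x ∈ A, ∀ y ∈ B, ¬ F.Adj x y := by
    intro x hx y hy hxy
    rw [mA] at hx
    rw [mB] at hy
    have h1 := h.move hx.1 hx.2 hxy
    refine hno (h1.hasFactor hy.1.symm ?_)
    rw [exchange_adj_iff hx.1.ne hxy.ne]
    rintro (⟨h2, -⟩ | ⟨-, rfl⟩ | ⟨-, rfl⟩)
    · exact hy.2 h2.symm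
    · exact hH hx.1
    · exact huv rfl
  set Q := A ∩ B with hQ
  set P := ((A ∪ B) ∪ {u, v})ᶜ with hP
  have hu : u ∉ A ∪ B := by
    rw [mem_union, mA, mB]
    rintro (h' | h')
    · exact h'.1.ne rfl
    · exact hH h'.1.symm
  have hv : v ∉ A ∪ B := by
    rw [mem_union, mA, mB]
    rintro (h' | h')
    · exact hH h'.1
    · exact h'.1.ne rfl
  have cP : #P + #A + #B + 2 = Fintype.card V + #Q := by
    have h1 : #((A ∪ B) ∪ {u, v}) = #(A ∪ B) + 2 := by
      rw [card_union_of_disjoint, card_pair huv]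
      rw [disjoint_right]
      intro z hz
      rw [mem_insert, mem_singleton] at hz
      rcases hz with rfl | rfl
      · exact hu
      · exact hv
    have h2 := Finset.card_compl_add_card ((A ∪ B) ∪ {u, v})
    have h3 := Finset.card_union_add_card_inter A B
    rw [← hP] at h2
    rw [← hQ] at h3
    omega
  have hQP : ∀ p ∈ Q, ∀ q, F.Adj p q → q ∈ P := by
    intro p hp q hpq
    rw [hQ, mem_inter] at hp
    rw [hP, mem_compl, mem_union, mem_union, mem_insert, mem_singleton]
    rintro ((h' | h') | rfl | rfl)
    · exact hAB q h' p hp.2 hpq.symm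
    · exact hAB p hp.1 q h' hpq
    · exact ((mA p).1 hp.1).2 hpq.symm
    · exact ((mB p).1 hp.2).2 hpq.symm
  have hQk : ∀ p ∈ Q, deg F p = k := by
    intro p hp
    rw [hQ, mem_inter] at hp
    refine h.degree_eq ?_ ?_
    · rintro rfl
      exact hu (mem_union_left _ hp.1)
    · rintro rfl
      exact hv (mem_union_left _ hp.1)
  obtain ⟨hle, heq⟩ := card_le_of_neighbors_subset hk hQk (fun q _ => h.degree_le q) hQP
  -- From `#Q ≤ #P` and `cP` the degree sum is at most `n + 2k - 4`. This refutes the first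
  -- alternative and gives `#P = #Q` in the second, so that all `F`-neighbours of `P` lie in `Q`.
  rcases hd with hd | ⟨hk2, hd⟩
  · omega
  have hPQ := heq (by omega)
  have hcase : ∀ z, z ∈ A ∨ z ∈ B ∨ z = u ∨ z = v ∨ z ∈ P := by
    intro z
    by_cases hz : z ∈ P
    · tauto
    · rw [hP, mem_compl, not_not] at hz
      simp only [mem_union, mem_insert, mem_singleton] at hz
      tauto
  obtain ⟨y1, hy1⟩ := exists_adj_of_degree_pos (F := F) (x := u) (by omega)
  obtain ⟨x1, hx1⟩ := exists_adj_of_degree_pos (F := F) (x := v) (by omega)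
  have hy1B : y1 ∈ B := by
    rcases hcase y1 with h' | h' | rfl | rfl | h'
    · exact absurd hy1 ((mA _).1 h').2
    · exact h'
    · exact absurd rfl hy1.ne
    · exact absurd hy1 hFuv
    · exact absurd (mem_union_left B (mem_inter.1 (hPQ y1 h' u hy1.symm)).1) hu
  have hx1A : x1 ∈ A := by
    rcases hcase x1 with h' | h' | rfl | rfl | h'
    · exact h'
    · exact absurd hx1 ((mB _).1 h').2
    · exact absurd hx1.symm hFuv
    · exact absurd rfl hx1.ne
    · exact absurd (mem_union_left B (mem_inter.1 (hPQ x1 h' v hx1.symm)).1) hv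
  have hx1u : x1 ≠ u := fun h' => hu (h' ▸ mem_union_left _ hx1A)
  have hx1d : deg F x1 = k := h.degree_eq hx1u hx1.ne'
  obtain ⟨x2, hx2, hx2v⟩ := exists_adj_ne_of_one_lt_degree (F := F) (x := x1) (by omega) v
  have hx2A : x2 ∈ A := by
    rcases hcase x2 with h' | h' | rfl | rfl | h'
    · exact h'
    · exact absurd hx2 (hAB x1 hx1A x2 h')
    · exact absurd hx2.symm ((mA _).1 hx1A).2
    · exact absurd rfl hx2v
    · exact absurd hx1 ((mB _).1 (mem_inter.1 (hPQ x2 h' x1 hx2.symm)).2).2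
  rw [mA] at hx1A hx2A
  rw [mB] at hy1B
  have hx2u : x2 ≠ u := hx2A.1.ne'
  -- The repair adds `u x1`, `u x2`, `v y1` and deletes `x1 x2`, `u y1`.
  have m1 := h.move hx1A.1 hx1A.2 hx2
  have hy1x1 : y1 ≠ x1 := by
    rintro rfl
    exact hy1B.2 hx1
  have a1 : ¬ (exchange F u x1 x2).Adj x2 u := by
    rw [exchange_adj_iff hx1A.1.ne hx2.ne]
    rintro (⟨h2, -⟩ | ⟨rfl, -⟩ | ⟨rfl, -⟩)
    · exact hx2A.2 h2.symm
    · exact hx2u rfl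
    · exact hx2.ne rfl
  have a2 : (exchange F u x1 x2).Adj u y1 := by
    rw [exchange_adj_iff hx1A.1.ne hx2.ne]
    refine Or.inl ⟨hy1, ?_⟩
    rintro (⟨rfl, -⟩ | ⟨rfl, -⟩)
    · exact hx1u rfl
    · exact hx2u rfl
  have m2 := m1.move hx2A.1.symm a1 a2
  refine hno (m2.hasFactor hy1B.1.symm ?_)
  rw [exchange_adj_iff hx2u hy1.ne, exchange_adj_iff hx1A.1.ne hx2.ne]
  have := hy1.ne
  have := hy1B.2
  have := F.adj_comm v y1
  grind

theorem HasFactor.nearFactor {G : SimpleGraph V} (huv : u ≠ v) (h : ¬ G.Adj u v)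
    (hf : HasFactor (G ⊔ SimpleGraph.edge u v) k) : HasFactor G k ∨ ∃ F, NearFactor G F k u v := by
  obtain ⟨F, hF, hreg⟩ := hf
  by_cases hadj : F.Adj u v
  · refine Or.inr ⟨F \ SimpleGraph.edge u v, sdiff_le_iff.2 (by rwa [sup_comm]), fun z => ?_⟩
    rw [degree_sdiff_edge F hadj, ← hreg z, degree_eq_deg]
  · refine Or.inl ⟨F, fun a b hab => ?_, hreg⟩
    have h1 := hF hab
    rw [SimpleGraph.sup_adj, SimpleGraph.edge_adj] at h1
    rcases h1 with h1 | ⟨⟨rfl, rfl⟩ | ⟨rfl, rfl⟩, -⟩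
    · exact h1
    · exact absurd hab hadj
    · exact absurd hab.symm hadj

/-- Undo the closure steps one at a time: a factor using the new edge `uv` becomes a near factor
without it, and the degree sum of `u` and `v` is what the Ore-type condition asks for. -/
theorem HasFactor.of_reflTransGen {G : SimpleGraph V} {l : ℕ}
    (hl : Fintype.card V + 2 * k ≤ l + 3 ∨ (2 ≤ k ∧ Fintype.card V + 2 * k ≤ l + 4))
    (h : Relation.ReflTransGen (ClosureStep l) G H) (hf : HasFactor H k) : HasFactor G k := by
  induction h using Relation.ReflTransGen.head_induction_on with
  | refl => exact hf
  | head hs _ ih =>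
    obtain ⟨u, v, huv, hn, hd, rfl⟩ := hs
    rw [degree_eq_deg, degree_eq_deg] at hd
    rcases HasFactor.nearFactor huv hn ih with h1 | ⟨F, hF⟩
    · exact h1
    · refine hF.hasFactor_of_degree_add huv hn ?_
      rcases hl with hl | hl
      · left; omega
      · right; omega

end Exchange
-- Closed graphs that are a clique outside a small set.
section Structure
open Classical

/-- There is a symmetric subset of `ZMod n` without `0` of every size `k < n` with `n * k` even. -/
theorem exists_symmetric_finset {n k : ℕ} [NeZero n] (hk : k < n) (h : Even (n * k)) :
    ∃ T : Finset (ZMod n), #T = k ∧ 0 ∉ T ∧ ∀ z ∈ T, -z ∈ T := by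
  have key : ∀ S : Finset ℕ, (∀ i ∈ S, 0 < i ∧ i < n ∧ n - i ∈ S) → #S = k →
      ∃ T : Finset (ZMod n), #T = k ∧ 0 ∉ T ∧ ∀ z ∈ T, -z ∈ T := by
    intro S hS hc
    refine ⟨univ.filter fun z => z.val ∈ S, ?_, ?_, ?_⟩
    · rw [← hc]
      refine Finset.card_bij (fun z _ => z.val) (fun z hz => (mem_filter.1 hz).2)
        (fun z _ z' _ hzz => ZMod.val_injective n hzz) fun i hi => ?_
      have := ZMod.val_cast_of_lt (hS i hi).2.1
      exact ⟨(i : ZMod n), by simpa [this] using hi, this⟩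
    · simp only [mem_filter, mem_univ, true_and, ZMod.val_zero]
      exact fun h0 => (hS 0 h0).1.ne rfl
    · intro z hz
      rw [mem_filter] at hz ⊢
      refine ⟨mem_univ _, ?_⟩
      have h0 : z ≠ 0 := by
        rintro rfl
        rw [ZMod.val_zero] at hz
        exact (hS 0 hz.2).1.ne rfl
      rw [ZMod.neg_val, if_neg h0]
      exact (hS _ hz.2).2.2
  -- Take an interval of residues symmetric about `n / 2`, without the midpoint if `n` and `k` are
  -- both even.
  rcases Nat.even_or_odd' n with ⟨m, hm | hm⟩ <;> rcases Nat.even_or_odd' k with ⟨j, hj | hj⟩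
  · refine key ((Icc (m - j) (m + j)).erase m) (fun i hi => ?_) ?_
    · simp only [mem_erase, mem_Icc] at hi ⊢
      omega
    · rw [card_erase_of_mem (by simp), Nat.card_Icc]
      omega
  · refine key (Icc (m - j) (m + j)) (fun i hi => ?_) ?_
    · simp only [mem_Icc] at hi ⊢
      omega
    · rw [Nat.card_Icc]
      omega
  · refine key (Icc (m + 1 - j) (m + j)) (fun i hi => ?_) ?_
    · simp only [mem_Icc] at hi ⊢
      omega
    · rw [Nat.card_Icc]
      omega
  · exfalso
    rw [Nat.even_mul, hm, hj] at h
    rcases h with h | h <;> revert h <;> simp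

variable {V : Type*} [Fintype V] {H F : SimpleGraph V} {k l t δ : ℕ} {B : Finset V}

/-- The factor is a Cayley graph of `ZMod n` with a symmetric connection set of size `k`. -/
theorem hasFactor_top (hk : k < Fintype.card V) (h : Even (Fintype.card V * k)) :
    HasFactor (⊤ : SimpleGraph V) k := by
  have : NeZero (Fintype.card V) := ⟨by omega⟩
  obtain ⟨T, hT, h0, hs⟩ := exists_symmetric_finset hk h
  let e : V ≃ ZMod (Fintype.card V) := Fintype.equivOfCardEq (ZMod.card _).symm
  let F : SimpleGraph V :=
    { Adj := fun u v => e u - e v ∈ T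
      symm := ⟨fun u v huv => by simpa using hs _ huv⟩
      loopless := ⟨fun u hu => h0 (by simpa using hu)⟩ }
  refine ⟨F, le_top, fun u => ?_⟩
  rw [degree_eq_deg, deg, ← hT]
  refine Finset.card_bij (fun v _ => e u - e v) (fun v hv => mem_nbr.1 hv)
    (fun v _ v' _ hvv => e.injective (sub_right_injective hvv)) fun z hz => ?_
  exact ⟨e.symm (e u - z), by rw [mem_nbr]; simpa [F] using hz, by simp⟩

theorem deg_mono (h : F ≤ H) (z : V) : deg F z ≤ deg H z :=
  Finset.card_le_card fun y hy => by simpa using h (by simpa using hy)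

theorem card_le_deg_of_clique (hK : ∀ u v, u ∉ B → v ∉ B → u ≠ v → H.Adj u v) {w : V}
    (hw : w ∉ B) : Fintype.card V ≤ deg H w + #B + 1 := by
  have h1 : (Bᶜ).erase w ⊆ nbr H w := fun y hy => by
    rw [mem_erase, mem_compl] at hy
    exact mem_nbr.2 (hK w y hw hy.2 hy.1.symm)
  have h2 := Finset.card_le_card h1
  rw [card_erase_of_mem (mem_compl.2 hw), card_compl] at h2
  rw [deg]
  omega

theorem card_add_le_deg_of_clique (hK : ∀ u v, u ∉ B → v ∉ B → u ≠ v → H.Adj u v) {w b : V}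
    (hw : w ∉ B) (hb : b ∈ B) (hbw : H.Adj b w) : Fintype.card V ≤ deg H w + #B := by
  have h1 : insert b ((Bᶜ).erase w) ⊆ nbr H w := fun y hy => by
    rw [mem_insert, mem_erase, mem_compl] at hy
    rcases hy with rfl | hy
    · exact mem_nbr.2 hbw.symm
    · exact mem_nbr.2 (hK w y hw hy.2 hy.1.symm)
  have h2 := Finset.card_le_card h1
  rw [card_insert_of_notMem (by simp [hb]), card_erase_of_mem (mem_compl.2 hw), card_compl] at h2
  have := Finset.card_lt_univ_of_notMem hw
  rw [deg]
  omega

/-- Nonadjacent pairs have degree sum less than `l`. -/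
def IsClosed (l : ℕ) (H : SimpleGraph V) : Prop :=
  ∀ u v, u ≠ v → ¬ H.Adj u v → deg H u + deg H v < l

theorem IsClosure.isClosed {G : SimpleGraph V} (h : IsClosure l G H) : IsClosed l H := by
  intro u v huv hn
  by_contra hlt
  refine h.2 _ ⟨u, v, huv, hn, ?_, rfl⟩
  rw [degree_eq_deg, degree_eq_deg]
  omega

/-- The degrees are at least `δ` at `b` and `n - 1 - #B` at `w`, while their sum is below `n + δ -
t`. With `#B ≤ t` there is no slack, and one neighbour of `w` in `B` would already exceed the bound.
-/
theorem IsClosed.of_not_adj (hc : IsClosed l H) (hδ : ∀ v, δ ≤ deg H v)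
    (hl : l + t = Fintype.card V + δ) (hB : #B ≤ t)
    (hK : ∀ u v, u ∉ B → v ∉ B → u ≠ v → H.Adj u v) {b w : V} (hb : b ∈ B) (hw : w ∉ B)
    (hbw : ¬ H.Adj b w) : #B = t ∧ deg H b = δ ∧ ∀ b' ∈ B, ¬ H.Adj b' w := by
  have h1 := card_le_deg_of_clique hK hw
  have h2 := hc b w (fun h => hw (h ▸ hb)) hbw
  have h3 := hδ b
  refine ⟨by omega, by omega, fun b' hb' hadj => ?_⟩
  have := card_add_le_deg_of_clique hK hw hb' hadj
  omega

theorem IsClosed.eq_top (hc : IsClosed l H) (hB : 2 * #B + l ≤ 2 * Fintype.card V)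
    (hK : ∀ u v, u ∉ B → v ∉ B → u ≠ v → H.Adj u v)
    (hadj : ∀ b ∈ B, ∀ w, w ∉ B → H.Adj b w) : H = ⊤ := by
  ext u v
  rw [SimpleGraph.top_adj]
  refine ⟨fun h => h.ne, fun huv => ?_⟩
  by_cases hu : u ∈ B <;> by_cases hv : v ∈ B
  · by_contra hn
    have h1 := hc u v huv hn
    have h2 : ∀ b ∈ B, Fintype.card V ≤ deg H b + #B := by
      intro b hb
      have : #(Bᶜ) ≤ deg H b := Finset.card_le_card fun w hw =>
        mem_nbr.2 (hadj b hb w (mem_compl.1 hw))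
      rw [card_compl] at this
      omega
    have := h2 u hu
    have := h2 v hv
    omega
  · exact hadj u hu v hv
  · exact (hadj v hv u hu).symm
  · exact hK u v hu hv huv

theorem le_of_closureSteps {G : SimpleGraph V} (h : Relation.ReflTransGen (ClosureStep l) G H) :
    G ≤ H := by
  induction h with
  | refl => exact le_rfl
  | tail _ hs ih => exact ih.trans hs.lt.le

/-- Joining a vertex of the small part to a vertex of the big clique makes the closure complete. -/
theorem hasFactor_sup_edge (hδ : ∀ v, δ ≤ deg H v)
    (hl : l + t = Fintype.card V + δ) (hB : #B ≤ t) (htn : 2 * t + l ≤ 2 * Fintype.card V)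
    (hK : ∀ u v, u ∉ B → v ∉ B → u ≠ v → H.Adj u v) {b w : V} (hb : b ∈ B) (hw : w ∉ B)
    (hbw : ¬ H.Adj b w) (hk : k < Fintype.card V) (hnk : Even (Fintype.card V * k))
    (hlk : Fintype.card V + 2 * k ≤ l + 3 ∨ (2 ≤ k ∧ Fintype.card V + 2 * k ≤ l + 4)) :
    HasFactor (H ⊔ SimpleGraph.edge b w) k := by
  obtain ⟨K, hcl⟩ := exists_isClosure l (H ⊔ SimpleGraph.edge b w)
  refine HasFactor.of_reflTransGen hlk hcl.1 ?_
  have hle : H ⊔ SimpleGraph.edge b w ≤ K := le_of_closureSteps hcl.1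
  have hne : b ≠ w := fun h => hw (h ▸ hb)
  have hdb : δ + 1 ≤ deg K b := by
    have h1 := deg_mono hle b
    rw [degree_sup_edge H hne hbw, if_pos rfl, if_neg hne] at h1
    have := hδ b
    omega
  have hcK := hcl.isClosed
  have hδK : ∀ v, δ ≤ deg K v := fun v => (hδ v).trans (deg_mono (le_sup_left.trans hle) v)
  have hKK : ∀ u v, u ∉ B → v ∉ B → u ≠ v → K.Adj u v := fun u v hu hv huv =>
    hle (Or.inl (hK u v hu hv huv))
  -- A nonadjacent pair across `B` in `K` would force every vertex of `B`, in particular `b`, to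
  -- have degree exactly `δ`; but `b` has gained an edge.
  have htop : K = ⊤ := by
    refine hcK.eq_top (B := B) (by omega) hKK fun b' hb' w' hw' => ?_
    by_contra hn
    have h1 := hcK.of_not_adj hδK hl hB hKK hb' hw' hn
    have h2 := hcK.of_not_adj hδK hl hB hKK hb hw' (h1.2.2 b hb)
    omega
  rw [htop]
  exact hasFactor_top hk hnk

/-- Two deficient vertices of a big clique can be repaired along an edge of the factor far away. -/
theorem NearFactor.hasFactor_of_clique {y w : V} (h : NearFactor H F k y w) (hk : 0 < k)
    (hK : ∀ u v, u ∉ B → v ∉ B → u ≠ v → H.Adj u v) (hn : 2 * #B + 2 * k + 4 < Fintype.card V)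
    (hy : y ∉ B) (hw : w ∉ B) : HasFactor H k := by
  set Y := nbr F y ∪ {y, w} with hY
  set Z := (nbr F w ∪ {y, w}) ∪ B with hZ
  have c2 : #({y, w} : Finset V) ≤ 2 := card_le_two
  have cY : #Y ≤ k + 2 := (card_union_le _ _).trans (Nat.add_le_add (h.degree_le y) c2)
  have cZ : #Z ≤ k + 2 + #B := (card_union_le _ _).trans (Nat.add_le_add_right
    ((card_union_le _ _).trans (Nat.add_le_add (h.degree_le w) c2)) _)
  have cX : Fintype.card V ≤ #((B ∪ Y)ᶜ) + #B + #Y := by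
    rw [card_compl]
    have := card_union_le B Y
    omega
  -- If all `F`-neighbours of `(B ∪ Y)ᶜ` lay in `Z`, this set would be no larger than `Z`, which the
  -- lower bound on `n` excludes. The edge `pq` is then replaced by `yp` and `qw`.
  have hex : ∃ p ∈ (B ∪ Y)ᶜ, ∃ q, F.Adj p q ∧ q ∉ Z := by
    by_contra! hcon
    have := (card_le_of_neighbors_subset hk (X := (B ∪ Y)ᶜ) (Z := Z) (F := F) (fun p hp => ?_)
      (fun q _ => h.degree_le q) hcon).1
    · omega
    · simp only [mem_compl, mem_union, hY, mem_insert, mem_singleton, not_or] at hp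
      exact h.degree_eq hp.2.2.1 hp.2.2.2
  obtain ⟨p, hp, q, hpq, hq⟩ := hex
  simp only [mem_compl, mem_union, hY, hZ, mem_insert, mem_singleton, not_or, mem_nbr] at hp hq
  have hyp := hK y p hy hp.1 (fun h => hp.2.2.1 h.symm)
  refine (h.move hyp hp.2.1 hpq).hasFactor (hK q w hq.2 hw hq.1.2.2) ?_
  rw [exchange_adj_iff hyp.ne hpq.ne]
  rintro (⟨h2, -⟩ | ⟨h2, -⟩ | ⟨rfl, -⟩)
  · exact hq.1.1 h2.symm
  · exact hq.1.2.1 h2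
  · exact hpq.ne rfl

/-- Either the near factor can be completed, or all factor neighbours of the vertices available
to `b` lie in `B`. -/
theorem NearFactor.hasFactor_or_neighbors {b w : V} (h : NearFactor H F k b w) (hk : 0 < k)
    (hK : ∀ u v, u ∉ B → v ∉ B → u ≠ v → H.Adj u v) (hn : 2 * #B + 2 * k + 4 < Fintype.card V)
    (hw : w ∉ B) : HasFactor H k ∨
      ∀ a ∈ nbr H b \ nbr F b, ∀ x, F.Adj a x → x ∈ B.erase b := by
  rw [or_iff_not_imp_left]
  intro hno a ha x hax
  rw [mem_sdiff, mem_nbr, mem_nbr] at ha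
  rw [mem_erase]
  refine ⟨?_, ?_⟩
  · rintro rfl
    exact ha.2 hax.symm
  · by_contra hx
    exact hno ((h.move ha.1 ha.2 hax).hasFactor_of_clique hk hK hn hx hw)

/-- If `b` cannot be repaired at once, the `#B + k - 3` vertices of `A` have all their
`F`-neighbours among the `#B - 1` vertices of `B.erase b`. Hence `k = 2`, with equality, and the
`F`-neighbours of `B.erase b` fill no more than `A`. The deficiency then goes from `b` through `a`
to `x ∈ B`, and from `x` through an `F`-neighbour `s` of `b` to a vertex `y` of the clique. -/
theorem NearFactor.hasFactor_of_two_le {b w : V} (h : NearFactor H F k b w) (hk : 2 ≤ k)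
    (hK : ∀ u v, u ∉ B → v ∉ B → u ≠ v → H.Adj u v) (hn : 2 * #B + 2 * k + 4 < Fintype.card V)
    (hb : b ∈ B) (hw : w ∉ B) (hbw : ¬ H.Adj b w) (hd : deg H b + 4 = #B + 2 * k)
    (hkd : k ≤ deg H b)
    (hS : ∀ z, z ∉ B → H.Adj b z → ∀ b' ∈ B, H.Adj b' z) : HasFactor H k := by
  have hne : b ≠ w := fun h => hw (h ▸ hb)
  rcases h.hasFactor_or_neighbors (by omega) hK hn hw with h' | hA
  · exact h'
  set A := nbr H b \ nbr F b with hAdef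
  have mA : ∀ z, z ∈ A ↔ H.Adj b z ∧ ¬ F.Adj b z := fun z => by simp [hAdef]
  have cA := card_sdiff_neighborFinset h.1 b
  rw [← hAdef] at cA
  have db := h.degree_left hne
  have hAk : ∀ a ∈ A, deg F a = k := fun a ha => by
    rw [mA] at ha
    exact h.degree_eq ha.1.ne' fun haw => hbw (haw ▸ ha.1)
  obtain ⟨hle, heq⟩ := card_le_of_neighbors_subset (by omega) hAk (fun q _ => h.degree_le q) hA
  rw [card_erase_of_mem hb] at hle heq
  have hBpos : 0 < #B := card_pos.2 ⟨b, hb⟩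
  have hBA := heq (by omega)
  obtain ⟨s, hs⟩ := exists_adj_of_degree_pos (F := F) (x := b) (by omega)
  have hsA : s ∉ A := fun hs' => ((mA s).1 hs').2 hs
  have hsB : s ∉ B := fun hs' =>
    ((mA b).1 (hBA s (mem_erase.2 ⟨hs.ne', hs'⟩) b hs.symm)).1.ne rfl
  have hsw : s ≠ w := fun h' => hbw (h' ▸ h.1 hs)
  have hsd := h.degree_eq hs.ne' hsw
  obtain ⟨y, hsy, hyb⟩ := exists_adj_ne_of_one_lt_degree (F := F) (x := s) (by omega) b
  have hyB : y ∉ B := fun hy => hsA (hBA y (mem_erase.2 ⟨hyb, hy⟩) s hsy.symm)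
  obtain ⟨a, ha⟩ : A.Nonempty := card_pos.1 (by omega)
  obtain ⟨x, hax⟩ := exists_adj_of_degree_pos (F := F) (x := a) (by have := hAk a ha; omega)
  have hxB := hA a ha x hax
  rw [mem_erase] at hxB
  have ha' := (mA a).1 ha
  have hsa : s ≠ a := fun h' => hsA (h' ▸ ha)
  have hsx : s ≠ x := fun h' => hsB (h' ▸ hxB.2)
  have m1 := h.move ha'.1 ha'.2 hax
  refine (m1.move (hS s hsB (h.1 hs) x hxB.2) ?_ ?_ (y := y)).hasFactor_of_clique (by omega)
    hK hn hyB hw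
  · rw [exchange_adj_iff ha'.1.ne hax.ne]
    rintro (⟨h2, -⟩ | ⟨h2, -⟩ | ⟨h2, -⟩)
    · exact hsA (hBA x (mem_erase.2 hxB) s h2)
    · exact hxB.1 h2
    · exact hax.ne h2.symm
  · rw [exchange_adj_iff ha'.1.ne hax.ne]
    exact Or.inl ⟨hsy, by tauto⟩

/-- A near 1-factor that cannot be completed forces the small part to be independent or to be
a component of even degree. -/
theorem NearFactor.hasFactor_one_or {b w : V} (h : NearFactor H F 1 b w)
    (hK : ∀ u v, u ∉ B → v ∉ B → u ≠ v → H.Adj u v) (hn : 2 * #B + 6 < Fintype.card V)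
    (hb : b ∈ B) (hw : w ∉ B) (hbw : ¬ H.Adj b w) (hd : ∀ b' ∈ B, deg H b' + 1 = #B)
    (hS : ∀ z, z ∉ B → ∀ b' ∈ B, H.Adj b' z → ∀ b'' ∈ B, H.Adj b'' z) :
    HasFactor H 1 ∨ (∀ z ∈ B, ¬ H.Adj b z) ∨ ((∀ z, z ∉ B → ¬ H.Adj b z) ∧ Even (deg H b)) := by
  have hne : b ≠ w := fun h => hw (h ▸ hb)
  rcases h.hasFactor_or_neighbors one_pos hK (by omega) hw with h' | hA
  · exact Or.inl h'
  have db := h.degree_left hne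
  have hFb : ∀ z, ¬ F.Adj b z := fun z hz => by
    have : 0 < deg F b := card_pos.2 ⟨z, mem_nbr.2 hz⟩
    omega
  have hFu : ∀ {z p q : V}, F.Adj z p → F.Adj z q → p = q := fun {z p q} hp hq =>
    Finset.card_le_one.1 (h.degree_le z) p (mem_nbr.2 hp) q (mem_nbr.2 hq)
  have hAe : nbr H b \ nbr F b = nbr H b := by
    ext z
    simp [hFb]
  rw [hAe] at hA
  have hAk : ∀ a ∈ nbr H b, deg F a = 1 := fun a ha => by
    rw [mem_nbr] at ha
    exact h.degree_eq ha.ne' fun haw => hbw (haw ▸ ha)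
  obtain ⟨hle, heq⟩ := card_le_of_neighbors_subset one_pos hAk (fun q _ => h.degree_le q) hA
  rw [card_erase_of_mem hb] at hle heq
  -- As `b` has `#B - 1` neighbours, `F` matches them exactly with `B.erase b`.
  have hdb := hd b hb
  have hBA : ∀ q ∈ B, q ≠ b → ∀ p, F.Adj q p → H.Adj b p := fun q hq hqb p hqp =>
    mem_nbr.1 (heq (by rw [deg] at hdb; omega) q (mem_erase.2 ⟨hqb, hq⟩) p hqp)
  have hAB : ∀ a, H.Adj b a → ∃ x, F.Adj a x ∧ x ∈ B ∧ x ≠ b := fun a ha => by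
    obtain ⟨x, hx⟩ := exists_adj_of_degree_pos (F := F) (x := a)
      (by rw [hAk a (mem_nbr.2 ha)]; exact one_pos)
    have := mem_erase.1 (hA a (mem_nbr.2 ha) x hx)
    exact ⟨x, hx, this.2, this.1⟩
  by_cases hSe : ∀ z, z ∉ B → ¬ H.Adj b z
  · refine Or.inr (Or.inr ⟨hSe, ?_⟩)
    have hAcl : ∀ a, H.Adj b a → ∀ x, F.Adj a x → H.Adj b x := fun a ha x hax =>
      hBA a (by_contra fun h' => hSe a h' ha) ha.ne' x hax
    -- `F` restricts to a perfect matching of the neighbourhood of `b`; the handshake lemma then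
    -- gives its parity.
    let F' : SimpleGraph V :=
      { Adj := fun u v => F.Adj u v ∧ H.Adj b u ∧ H.Adj b v
        symm := ⟨fun u v huv => ⟨huv.1.symm, huv.2.2, huv.2.1⟩⟩
        loopless := ⟨fun u hu => hu.1.ne rfl⟩ }
    have hdeg : ∀ v, Odd (F'.degree v) ↔ v ∈ nbr H b := by
      intro v
      rw [degree_eq_deg, mem_nbr]
      constructor
      · intro ho
        obtain ⟨y, hy⟩ := exists_adj_of_degree_pos (F := F') (x := v) ho.pos
        exact hy.2.1
      · intro hv
        have : nbr F' v = nbr F v := by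
          ext y
          rw [mem_nbr, mem_nbr]
          exact ⟨fun hy => hy.1, fun hy => ⟨hy, hv, hAcl v hv y hy⟩⟩
        rw [deg, this, ← deg, hAk v (mem_nbr.2 hv)]
        exact odd_one
    have hev := F'.even_card_odd_degree_vertices
    rw [deg]
    convert hev using 2
    ext v
    rw [mem_filter, hdeg]
    simp
  by_cases hN : ∀ z ∈ B, ¬ H.Adj b z
  · exact Or.inr (Or.inl hN)
  left
  push Not at hSe hN
  obtain ⟨s, hsB, hs⟩ := hSe
  obtain ⟨x, hsx, hxB, hxb⟩ := hAB s hs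
  have hNN : ∀ y ∈ B, H.Adj b y → ∀ y', F.Adj y y' → y' ∈ B ∧ H.Adj b y' := by
    intro y hy hby y' hyy'
    obtain ⟨x', hx', hx'B, -⟩ := hAB y hby
    rw [hFu hyy' hx']
    exact ⟨hx'B, hBA y hy hby.ne' x' hx'⟩
  have hbx : ¬ H.Adj b x := fun hbx => hsB (hNN x hxB hbx s hsx.symm).1
  -- Otherwise the neighbours of `x` all lie outside `B`, so they are neighbours of `b`. But `b`
  -- also has one in `B`, contradicting equality of degrees.
  have hz : ∃ z ∈ B, H.Adj x z := by
    by_contra! hcon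
    obtain ⟨y, hyB, hby⟩ := hN
    have hss : nbr H x ⊂ nbr H b := by
      refine ssubset_of_subset_of_ne (fun z hz => ?_) fun he => ?_
      · rw [mem_nbr] at hz ⊢
        exact hS z (fun hzB => hcon z hzB hz) x hxB hz b hb
      · have : y ∈ nbr H x := he ▸ mem_nbr.2 hby
        exact hcon y hyB (mem_nbr.1 this)
    have h1 := card_lt_card hss
    have h2 := hd x hxB
    rw [deg] at h2 hdb
    omega
  obtain ⟨z, hzB, hxz⟩ := hz
  have hzb : z ≠ b := by
    rintro rfl
    exact hbx hxz.symm
  have hxs : ¬ F.Adj z x := fun hzx => hsB (hFu hsx.symm hzx.symm ▸ hzB)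
  -- the partner `p` of `z` is adjacent to `b`
  have hdz : deg F z = 1 := h.degree_eq hzb fun hzw => hw (hzw ▸ hzB)
  obtain ⟨p, hzp⟩ := exists_adj_of_degree_pos (F := F) (x := z) (by omega)
  have hbp := hBA z hzB hzb p hzp
  have m1 := h.move hbp (hFb p) hzp.symm
  have hpx : p ≠ x := by
    rintro rfl
    exact hxs hzp
  have hps : p ≠ s := by
    rintro rfl
    exact hxz.ne (hFu hsx hzp.symm)
  -- Along the alternating path `b p z x s` the deficiency reaches `s` in the clique.
  refine (m1.move hxz.symm ?_ ?_ (y := s)).hasFactor_of_clique one_pos hK (by omega) hsB hw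
  · rw [exchange_adj_iff hbp.ne hzp.ne']
    rintro (⟨h2, -⟩ | ⟨h2, -⟩ | ⟨h2, -⟩)
    · exact hxs h2
    · exact hzb h2
    · exact hzp.ne h2
  · rw [exchange_adj_iff hbp.ne hzp.ne']
    refine Or.inl ⟨hsx.symm, ?_⟩
    rintro (⟨h2, -⟩ | ⟨-, h2⟩)
    · exact hpx h2.symm
    · exact hps h2.symm

/-! ### Recognising the two exceptional graphs. -/

theorem nonempty_iso_sum_complete {m r : ℕ} (hm : m + #B = Fintype.card V) (hr : #B = r)
    (hK : ∀ u v, u ∉ B → v ∉ B → u ≠ v → H.Adj u v)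
    (hBB : ∀ u ∈ B, ∀ v ∈ B, u ≠ v → H.Adj u v) (hKB : ∀ u ∈ B, ∀ v, v ∉ B → ¬ H.Adj u v) :
    Nonempty (H ≃g (SimpleGraph.completeGraph (Fin m) ⊕g SimpleGraph.completeGraph (Fin r))) := by
  let e₁ : Fin m ≃ {v // v ∉ B} := Fintype.equivOfCardEq (by
    rw [Fintype.card_fin, Fintype.card_subtype_compl, Fintype.card_coe]; omega)
  let e₂ : Fin r ≃ {v // v ∈ B} := Fintype.equivOfCardEq (by
    rw [Fintype.card_fin, Fintype.card_coe, hr])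
  let f : Fin m ⊕ Fin r → V := Sum.elim (fun i => e₁ i) fun i => e₂ i
  have hf₁ : ∀ i, f (Sum.inl i) ∉ B := fun i => (e₁ i).2
  have hf₂ : ∀ i, f (Sum.inr i) ∈ B := fun i => (e₂ i).2
  have hinj : Function.Injective f := by
    rintro (i | i) (j | j) hij
    · exact congrArg _ (e₁.injective (Subtype.ext hij))
    · exact absurd (hij ▸ hf₂ j) (hf₁ i)
    · exact absurd (hij ▸ hf₂ i) (hf₁ j)
    · exact congrArg _ (e₂.injective (Subtype.ext hij))
  have hbij : Function.Bijective f := (Fintype.bijective_iff_injective_and_card f).2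
    ⟨hinj, by rw [Fintype.card_sum, Fintype.card_fin, Fintype.card_fin]; omega⟩
  refine ⟨RelIso.symm ⟨Equiv.ofBijective f hbij, ?_⟩⟩
  rintro (i | i) (j | j)
  · simp only [Equiv.ofBijective_apply, SimpleGraph.sum_adj, SimpleGraph.completeGraph_eq_top,
      SimpleGraph.top_adj]
    exact ⟨fun h hij => h.ne (by rw [hij]), fun h => hK _ _ (hf₁ i) (hf₁ j)
      fun hij => h (Sum.inl_injective (hinj hij))⟩
  · simp only [Equiv.ofBijective_apply, SimpleGraph.sum_adj, iff_false]
    exact fun h => hKB _ (hf₂ j) _ (hf₁ i) h.symm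
  · simp only [Equiv.ofBijective_apply, SimpleGraph.sum_adj, iff_false]
    exact fun h => hKB _ (hf₂ i) _ (hf₁ j) h
  · simp only [Equiv.ofBijective_apply, SimpleGraph.sum_adj, SimpleGraph.completeGraph_eq_top,
      SimpleGraph.top_adj]
    exact ⟨fun h hij => h.ne (by rw [hij]), fun h => hBB _ (hf₂ i) _ (hf₂ j)
      fun hij => h (Sum.inr_injective (hinj hij))⟩

theorem nonempty_iso_join {S : Finset V} {s m r : ℕ} (hSB : Disjoint S B) (hs : #S = s)
    (hr : #B = r) (hm : s + m + r = Fintype.card V)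
    (hH : ∀ u v, H.Adj u v ↔ u ≠ v ∧ (u ∈ S ∨ v ∈ S ∨ (u ∉ B ∧ v ∉ B))) :
    Nonempty (H ≃g join (SimpleGraph.completeGraph (Fin s))
      (SimpleGraph.completeGraph (Fin m) ⊕g SimpleGraph.emptyGraph (Fin r))) := by
  let e₀ : Fin s ≃ {v // v ∈ S} := Fintype.equivOfCardEq (by
    rw [Fintype.card_fin, Fintype.card_coe, hs])
  let e₁ : Fin m ≃ {v // v ∉ S ∪ B} := Fintype.equivOfCardEq (by
    rw [Fintype.card_fin, Fintype.card_subtype_compl, Fintype.card_coe,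
      card_union_of_disjoint hSB]
    omega)
  let e₂ : Fin r ≃ {v // v ∈ B} := Fintype.equivOfCardEq (by
    rw [Fintype.card_fin, Fintype.card_coe, hr])
  let f : Fin s ⊕ (Fin m ⊕ Fin r) → V :=
    Sum.elim (fun i => e₀ i) (Sum.elim (fun i => e₁ i) fun i => e₂ i)
  have hf₀ : ∀ i, f (Sum.inl i) ∈ S := fun i => (e₀ i).2
  have hf₁ : ∀ i, f (Sum.inr (Sum.inl i)) ∉ S ∧ f (Sum.inr (Sum.inl i)) ∉ B := fun i => by
    have := (e₁ i).2
    rwa [mem_union, not_or] at this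
  have hf₂ : ∀ i, f (Sum.inr (Sum.inr i)) ∈ B := fun i => (e₂ i).2
  have hf₃ : ∀ i, f (Sum.inr (Sum.inr i)) ∉ S := fun i hi =>
    Finset.disjoint_left.1 hSB hi (hf₂ i)
  have hinj : Function.Injective f := by
    rintro (i | i | i) (j | j | j) hij
    · exact congrArg _ (e₀.injective (Subtype.ext hij))
    · exact absurd (hij ▸ hf₀ i) (hf₁ j).1
    · exact absurd (hij ▸ hf₀ i) (hf₃ j)
    · exact absurd (hij ▸ hf₀ j) (hf₁ i).1
    · exact congrArg _ (congrArg _ (e₁.injective (Subtype.ext hij)))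
    · exact absurd (hij ▸ hf₂ j) (hf₁ i).2
    · exact absurd (hij ▸ hf₀ j) (hf₃ i)
    · exact absurd (hij ▸ hf₂ i) (hf₁ j).2
    · exact congrArg _ (congrArg _ (e₂.injective (Subtype.ext hij)))
  have hbij : Function.Bijective f := (Fintype.bijective_iff_injective_and_card f).2
    ⟨hinj, by simp only [Fintype.card_sum, Fintype.card_fin]; omega⟩
  refine ⟨RelIso.symm ⟨Equiv.ofBijective f hbij, ?_⟩⟩
  intro a b
  rw [Equiv.ofBijective_apply, Equiv.ofBijective_apply, hH, hinj.ne_iff]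
  rcases a with i | i | i <;> rcases b with j | j | j <;>
    simp [join, hf₀, hf₁, hf₂, hf₃]

end Structure
-- Real inequalities turning the spectral hypothesis into a contradiction.
section Estimates

/-- The difference of the two sides is a cubic in `b`, and `hc` says that its second divided
difference at `b₁`, `b`, `b₂` is at most zero. So the cubic lies above its chord, and positivity at
the endpoints suffices. -/
theorem concave_cubic_pos {α c P b b₁ b₂ : ℝ} (h₁ : b₁ ≤ b) (h₂ : b ≤ b₂)
    (hc : 0 ≤ 2 * (b + b₁ + b₂) + α + 3 * c)
    (hb₁ : b₁ * (b₁ + c) ^ 2 < (α + b₁) * (P - (b₁ + c) * b₁))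
    (hb₂ : b₂ * (b₂ + c) ^ 2 < (α + b₂) * (P - (b₂ + c) * b₂)) :
    b * (b + c) ^ 2 < (α + b) * (P - (b + c) * b) := by
  rcases h₁.eq_or_lt with rfl | hlt
  · exact hb₁
  have key : ((α + b) * (P - (b + c) * b) - b * (b + c) ^ 2) * (b₂ - b₁) =
      (b₂ - b) * ((α + b₁) * (P - (b₁ + c) * b₁) - b₁ * (b₁ + c) ^ 2) +
      (b - b₁) * ((α + b₂) * (P - (b₂ + c) * b₂) - b₂ * (b₂ + c) ^ 2) +
      (b - b₁) * (b₂ - b) * (b₂ - b₁) * (2 * (b + b₁ + b₂) + α + 3 * c) := by ring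
  have t1 := mul_nonneg (sub_nonneg.2 h₂) (sub_pos.2 hb₁).le
  have t2 := mul_pos (sub_pos.2 hlt) (sub_pos.2 hb₂)
  have t3 := mul_nonneg (mul_nonneg (mul_nonneg (sub_pos.2 hlt).le (sub_nonneg.2 h₂))
    (sub_pos.2 (hlt.trans_le h₂)).le) hc
  have h : 0 < ((α + b) * (P - (b + c) * b) - b * (b + c) ^ 2) * (b₂ - b₁) := by
    rw [key]; linarith
  exact sub_pos.1 (pos_of_mul_pos_left h (sub_pos.2 (hlt.trans_le h₂)).le)

theorem spectral_estimate_matching {n δ b ρ : ℝ} (hδ : 1 ≤ δ) (hn : 6 * δ + 10 ≤ n)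
    (hb : δ + 2 ≤ b) (hbn : 2 * b ≤ n)
    (hρ : (δ - 1) / 2 + √(n ^ 2 - (3 * δ + 5) * n + (13 * δ ^ 2 + 23 * δ + 41) / 4) < ρ) :
    b - 1 < ρ ∧ 0 < ρ * (ρ + 1) - (b - 1) * b ∧
      b * (b - 1) ^ 2 < (ρ + 1 - n + b) * (ρ * (ρ + 1) - (b - 1) * b) := by
  set X := n ^ 2 - (3 * δ + 5) * n + (13 * δ ^ 2 + 23 * δ + 41) / 4 with hX
  have hs0 := Real.sqrt_nonneg X
  have hy0 : 0 < ρ - (δ - 1) / 2 := by linarith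
  have hsq : X < (ρ - (δ - 1) / 2) ^ 2 := (Real.sqrt_lt' hy0).1 (by linarith)
  obtain ⟨z, rfl⟩ : ∃ z, n = 6 * δ + 10 + z := ⟨n - (6 * δ + 10), by ring⟩
  -- Here `q` is the excess of `ρ` over `n - δ - 3`, the spectral radius of the clique left by `δ +
  -- 2` vertices; thus `ρ + 1 - n + b = q` at the endpoint `b = δ + 2`.
  obtain ⟨q, rfl⟩ : ∃ q, ρ = 5 * δ + 7 + z + q := ⟨ρ - (5 * δ + 7 + z), by ring⟩
  have hz : 0 ≤ z := by linarith
  have hq1 : δ ^ 2 - 7 / 4 * δ + 4 < q * (9 * δ + 15 + 2 * z + q) := by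
    rw [hX] at hsq
    linarith
  have hR : 0 < δ ^ 2 - 7 / 4 * δ + 4 := by nlinarith [sq_nonneg (δ - 1)]
  have hq : 0 < q := by
    have hw : 0 < 9 * δ + 15 + 2 * z + q := by linarith
    exact pos_of_mul_pos_left (hR.trans hq1) hw.le
  set h := (6 * δ + 10 + z) / 2 with hh
  have hbρ : b - 1 < 5 * δ + 7 + z + q := by linarith
  have hδ0 : 0 ≤ δ := by linarith
  refine ⟨hbρ, ?_, ?_⟩
  · have := mul_lt_mul'' hbρ (show b < 5 * δ + 7 + z + q + 1 by linarith) (by linarith)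
      (by linarith)
    linarith
  have key := concave_cubic_pos (α := 5 * δ + 7 + z + q + 1 - (6 * δ + 10 + z)) (c := -1)
    (P := (5 * δ + 7 + z + q) * (5 * δ + 7 + z + q + 1)) (b := b) (b₁ := δ + 2) (b₂ := h)
    hb (by linarith) (by linarith) ?_ ?_
  · exact key
  · set R := δ ^ 2 - 7 / 4 * δ + 4 with hRdef
    set C := (δ + 2) * (δ + 1) ^ 2 with hC
    have hC0 : 0 < C := by positivity
    have p1 : C * (9 * δ + 15) ≤ R * (6 * (2 * δ + 3) ^ 2) := by
      rw [hC, hRdef]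
      linarith [sq_nonneg (δ ^ 2 - 7 / 10 * δ - 3), sq_nonneg δ]
    have p2 : C * 2 ≤ R * (10 * δ + 15) := by
      rw [hC, hRdef]
      nlinarith [mul_nonneg (sub_nonneg.2 hδ) (sq_nonneg (δ - 1)), sq_nonneg (δ - 1)]
    have p3 : C * (9 * δ + 15 + 2 * z + q) ≤
        R * (6 * (2 * δ + 3) ^ 2 + (10 * δ + 15) * z + (10 * δ + 15) * q) := by
      linarith [mul_le_mul_of_nonneg_right p2 hz, mul_le_mul_of_nonneg_right p2 hq.le,
        mul_pos hC0 hq]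
    -- To eliminate `q`, multiply the goal by `R` and insert `hq1`; what remains is the comparison
    -- `p3` of coefficients.
    have p4 : C * R < R * (q * (6 * (2 * δ + 3) ^ 2 + (10 * δ + 15) * z + (10 * δ + 15) * q)) := by
      linarith [mul_le_mul_of_nonneg_left p3 hq.le, mul_lt_mul_of_pos_left hq1 hC0]
    have p5 : C < q * (6 * (2 * δ + 3) ^ 2 + (10 * δ + 15) * z + (10 * δ + 15) * q) := by
      refine lt_of_mul_lt_mul_left ?_ hR.le
      linarith
    have p6 : 0 ≤ q * (z ^ 2 + 2 * z * q + q ^ 2) := by positivity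
    calc (δ + 2) * (δ + 2 + -1) ^ 2 = C := by rw [hC]; ring
      _ < _ := p5
      _ ≤ _ := by linarith
  · have hh1 : 1 < h := by linarith
    have e1 : h * (h - 1) ≤ (5 * δ + 7 + z + q) * (5 * δ + 7 + z + q + 1 - h) := by
      rw [hh, ← sub_nonneg]
      ring_nf
      positivity
    set ρ := 5 * δ + 7 + z + q with hρdef
    have e2 : h * ρ ≤ ρ * (ρ + 1) - (h - 1) * h := by linarith
    have e3 : 0 < ρ + 1 - h := by linarith
    have e4 := mul_le_mul_of_nonneg_left e2 e3.le
    have e5 := mul_le_mul_of_nonneg_left e1 (by linarith : (0:ℝ) ≤ h)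
    have e6 : h * (h - 1) ^ 2 < h * (h * (h - 1)) := by
      have := mul_pos (by linarith : 0 < h) (by linarith : 0 < h - 1)
      linarith
    have e7 : ρ + 1 - (6 * δ + 10 + z) + h = ρ + 1 - h := by rw [hh]; ring
    rw [e7]
    calc h * (h + -1) ^ 2 = h * (h - 1) ^ 2 := by ring
      _ < h * (h * (h - 1)) := e6
      _ ≤ (ρ + 1 - h) * (h * ρ) := by linarith
      _ ≤ (ρ + 1 - h) * (ρ * (ρ + 1) - (h - 1) * h) := e4
      _ = _ := by ring

theorem spectral_estimate_factor {n δ k b ρ : ℝ} (hk : 2 ≤ k) (hδ : 2 * k - 2 ≤ δ)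
    (hn : 6 * δ + 4 * k - 3 ≤ n) (hb : δ - 2 * k + 5 ≤ b) (hbn : 2 * b ≤ n - 2 * k + 4)
    (hρ : (δ - 1) / 2 + √(n ^ 2 - (3 * δ - 4 * k + 11) * n
      + (13 * δ ^ 2 - (32 * k - 94) * δ + 16 * k ^ 2 - 104 * k + 161) / 4) < ρ) :
    b + (2 * k - 4) < ρ ∧ 0 < ρ * (ρ + 1) - (b + (2 * k - 4)) * b ∧
      b * (b + (2 * k - 4)) ^ 2 <
        (ρ + 1 - n + b) * (ρ * (ρ + 1) - (b + (2 * k - 4)) * b) := by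
  set X := n ^ 2 - (3 * δ - 4 * k + 11) * n
      + (13 * δ ^ 2 - (32 * k - 94) * δ + 16 * k ^ 2 - 104 * k + 161) / 4 with hX
  have hs0 := Real.sqrt_nonneg X
  have hy0 : 0 < ρ - (δ - 1) / 2 := by linarith
  have hsq : X < (ρ - (δ - 1) / 2) ^ 2 := (Real.sqrt_lt' hy0).1 (by linarith)
  -- Now `u = 2k - 4` and `s = δ + 2 - 2k`, so the smallest `b` is `3 + s`; again `q` is chosen so
  -- that `ρ + 1 - n + b = q` there.
  obtain ⟨u, rfl⟩ : ∃ u, k = 2 + u / 2 := ⟨2 * k - 4, by ring⟩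
  obtain ⟨s, rfl⟩ : ∃ s, δ = 2 + u + s := ⟨δ - 2 - u, by ring⟩
  obtain ⟨z, rfl⟩ : ∃ z, n = 17 + 8 * u + 6 * s + z := ⟨n - (17 + 8 * u + 6 * s), by ring⟩
  obtain ⟨q, rfl⟩ : ∃ q, ρ = 13 + 8 * u + 5 * s + z + q :=
    ⟨ρ - (13 + 8 * u + 5 * s + z), by ring⟩
  have hu : 0 ≤ u := by linarith
  have hs : 0 ≤ s := by linarith
  have hz : 0 ≤ z := by linarith
  have hq1 : (4 + u + s) * (3 + s) < q * (25 + 15 * u + 9 * s + 2 * z + q) := by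
    rw [hX] at hsq
    linarith
  have hq : 0 < q := by
    have hw : 0 < 25 + 15 * u + 9 * s + 2 * z + q := by linarith
    refine pos_of_mul_pos_left (lt_trans ?_ hq1) hw.le
    positivity
  have hb3 : 3 + s ≤ b := by linarith
  have hbh : b ≤ (17 + 7 * u + 6 * s + z) / 2 := by linarith
  have hc : 2 * (2 + u / 2) - 4 = u := by ring
  rw [hc]
  refine ⟨by linarith, ?_, ?_⟩
  · have := mul_lt_mul'' (show b + u < 13 + 8 * u + 5 * s + z + q by linarith)
      (show b < 13 + 8 * u + 5 * s + z + q + 1 by linarith) (by linarith) (by linarith)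
    linarith
  refine concave_cubic_pos (b₁ := 3 + s) (b₂ := (17 + 7 * u + 6 * s + z) / 2) hb3 hbh
    (by linarith) ?_ ?_
  · have h1 : (3 + u + s) * (25 + 15 * u + 9 * s + 2 * z + q) ≤
        (13 + 8 * u + 5 * s + z + q) * (13 + 8 * u + 5 * s + z + q + 1)
          - (3 + s + u) * (3 + s) := by
      rw [← sub_nonneg]
      ring_nf
      positivity
    have h2 := mul_le_mul_of_nonneg_left h1 hq.le
    have h3 := mul_lt_mul_of_pos_left hq1 (by positivity : 0 < 3 + u + s)
    have h4 : 0 < (3 + s) * (3 + s + u) := by positivity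
    linarith
  · set h := (17 + 7 * u + 6 * s + z) / 2 with hh
    set e := (17 + 9 * u + 6 * s + z) / 2 with he
    set ρ := 13 + 8 * u + 5 * s + z + q with hρdef
    have e0 : h + u = e := by rw [hh, he]; ring
    have e1 : e * h < ρ * (ρ - e + 1) := by
      have base : 0 < 4 * (ρ * (ρ - e + 1) - e * h) := by
        have hexp : 4 * (ρ * (ρ - e + 1) - e * h) =
            -3 + 10 * s + 14 * z + 86 * u + 4 * s ^ 2 + 6 * (s * z) + z ^ 2 + 49 * u ^ 2
              + 38 * (u * s) + 14 * (u * z)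
              + q * (74 + 46 * u + 28 * s + 6 * z + 4 * q) := by
          rw [hρdef, he, hh]; ring
        rw [hexp]
        have hrest : 0 ≤ 4 * s ^ 2 + 6 * (s * z) + z ^ 2 + 49 * u ^ 2
              + 38 * (u * s) + 14 * (u * z) := by positivity
        have hq2 : 12 < q * (74 + 46 * u + 28 * s + 6 * z + 4 * q) := by
          refine lt_of_le_of_lt ?_ (hq1.trans_le
            (mul_le_mul_of_nonneg_left (by linarith) hq.le))
          have := mul_nonneg hu hs
          have := mul_nonneg hs hs
          linarith
        linarith
      linarith
    have hρ0 : 0 < ρ := by positivity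
    have e2 : e * ρ < ρ * (ρ + 1) - e * h := by linarith
    have e3 : 0 < ρ - e + 1 := by rw [hρdef, he]; linarith
    have he0 : 0 < e := by positivity
    have e4 := mul_lt_mul_of_pos_left e2 e3
    have e5 := mul_lt_mul_of_pos_left e1 he0
    have e6 : ρ + 1 - (17 + 8 * u + 6 * s + z) + h = ρ - e + 1 := by rw [hh, he]; ring
    rw [e0, e6]
    linarith

end Estimates

/-! ### Assembling the two statements. -/

section Main
open Classical

variable {V : Type*} [Fintype V]

/-- Lets `ρ(G)` be tested directly on the closure, without comparing spectral radii. -/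
theorem subeigenvector_mono {G H : SimpleGraph V} (hGH : G ≤ H)
    [DecidableRel G.Adj] {x : V → ℝ} (hx : ∀ v, 0 ≤ x v) {ρ : ℝ}
    (h : ∀ v, ρ * x v ≤ ∑ u ∈ G.neighborFinset v, x u) (v : V) :
    ρ * x v ≤ ∑ u ∈ H.neighborFinset v, x u :=
  (h v).trans (Finset.sum_le_sum_of_subset_of_nonneg
    (fun u hu => by
      rw [SimpleGraph.mem_neighborFinset] at hu ⊢
      exact hGH hu)
    fun u _ _ => hx u)

/-- If no large set consists of vertices of small degree, then all but few vertices of a closed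
graph form a clique. -/
theorem IsClosed.exists_clique_compl {H : SimpleGraph V} {l t : ℕ} (hc : IsClosed l H)
    (ht : 2 * (t + 1) + l ≤ 2 * Fintype.card V) (hnl : Fintype.card V ≤ l + 1)
    (hspec : ∀ (B : Finset V) (e : ℕ), (∀ v ∈ B, deg H v ≤ e) → e + Fintype.card V = #B + l →
      t + 1 ≤ #B → ¬ 2 * #B + l ≤ 2 * Fintype.card V) :
    ∃ B : Finset V, #B ≤ t ∧ ∀ u v, u ∉ B → v ∉ B → u ≠ v → H.Adj u v := by
  set B : Finset V := {v | 2 * deg H v < l} with hB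
  have mB : ∀ v, v ∈ B ↔ 2 * deg H v < l := fun v => by simp [hB]
  have hK : ∀ u v, u ∉ B → v ∉ B → u ≠ v → H.Adj u v := by
    intro u v hu hv huv
    by_contra hn
    have := hc u v huv hn
    rw [mB] at hu hv
    omega
  refine ⟨B, ?_, hK⟩
  by_contra! hlt
  -- In the first case each `v ∈ B` misses some `w ∉ B`, whose large degree bounds that of `v`. In
  -- the second `B` is too big for this, and a subset of size `(2n - l) / 2` is used, for which the
  -- defining bound `2 * deg < l` is enough.
  by_cases hcase : 2 * #B + l + 2 ≤ 2 * Fintype.card V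
  · refine hspec B (#B + l - Fintype.card V) (fun v hv => ?_) (by omega) hlt (by omega)
    have hex : ∃ w, w ∉ B ∧ ¬ H.Adj v w := by
      by_contra! hcon
      have h1 : #(Bᶜ) ≤ deg H v := Finset.card_le_card fun w hw =>
        mem_nbr.2 (hcon w (mem_compl.1 hw))
      rw [card_compl] at h1
      have := (mB v).1 hv
      omega
    obtain ⟨w, hw, hvw⟩ := hex
    have h1 := hc v w (fun h : v = w => hw (h ▸ hv)) hvw
    have h2 := card_le_deg_of_clique hK hw
    omega
  · obtain ⟨B₀, hB₀, hcard⟩ := Finset.exists_subset_card_eq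
      (show (2 * Fintype.card V - l) / 2 ≤ #B by omega)
    refine hspec B₀ (#B₀ + l - Fintype.card V) (fun v hv => ?_) (by omega) (by omega) (by omega)
    have := (mB v).1 (hB₀ hv)
    omega

theorem IsClosed.hasFactor_or_nearFactor {H : SimpleGraph V} {k l t δ : ℕ} {B : Finset V}
    (hc : IsClosed l H) (hδ : ∀ v, δ ≤ deg H v)
    (hl : l + t = Fintype.card V + δ) (hB : #B ≤ t) (htn : 2 * t + l ≤ 2 * Fintype.card V)
    (hK : ∀ u v, u ∉ B → v ∉ B → u ≠ v → H.Adj u v)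
    (hk : k < Fintype.card V) (hnk : Even (Fintype.card V * k))
    (hlk : Fintype.card V + 2 * k ≤ l + 3 ∨ (2 ≤ k ∧ Fintype.card V + 2 * k ≤ l + 4)) :
    HasFactor H k ∨ ∃ b ∈ B, ∃ w, w ∉ B ∧ ¬ H.Adj b w ∧ ∃ F, NearFactor H F k b w := by
  by_cases hadj : ∀ b ∈ B, ∀ w, w ∉ B → H.Adj b w
  · left
    rw [hc.eq_top (by omega) hK hadj]
    exact hasFactor_top hk hnk
  · push Not at hadj
    obtain ⟨b, hb, w, hw, hbw⟩ := hadj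
    exact (HasFactor.nearFactor (fun h : b = w => hw (h ▸ hb)) hbw
      (hasFactor_sup_edge hδ hl hB htn hK hb hw hbw hk hnk hlk)).imp_right
      fun hF => ⟨b, hb, w, hw, hbw, hF⟩

theorem IsClosed.deg_eq_of_not_adj {H : SimpleGraph V} {l t δ : ℕ} {B : Finset V}
    (hc : IsClosed l H) (hδ : ∀ v, δ ≤ deg H v)
    (hl : l + t = Fintype.card V + δ) (hB : #B ≤ t)
    (hK : ∀ u v, u ∉ B → v ∉ B → u ≠ v → H.Adj u v) {b w : V} (hb : b ∈ B) (hw : w ∉ B)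
    (hbw : ¬ H.Adj b w) : #B = t ∧ ∀ b' ∈ B, deg H b' = δ := by
  have h1 := hc.of_not_adj hδ hl hB hK hb hw hbw
  exact ⟨h1.1, fun b' hb' => (hc.of_not_adj hδ hl hB hK hb' hw (h1.2.2 b' hb')).2.1⟩

theorem IsClosed.adj_of_adj {H : SimpleGraph V} {l t δ : ℕ} {B : Finset V}
    (hc : IsClosed l H) (hδ : ∀ v, δ ≤ deg H v)
    (hl : l + t = Fintype.card V + δ) (hB : #B ≤ t)
    (hK : ∀ u v, u ∉ B → v ∉ B → u ≠ v → H.Adj u v) {w : V} (hw : w ∉ B) {b : V} (hb : b ∈ B)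
    (hbw : H.Adj b w) : ∀ b' ∈ B, H.Adj b' w := by
  intro b' hb'
  by_contra hn
  exact (hc.of_not_adj hδ hl hB hK hb' hw hn).2.2 b hb hbw

theorem hasFactor_one_or_of_closure {G : SimpleGraph V} {n δ : ℕ} (hn : Fintype.card V = n)
    (hδ : ∀ v, δ ≤ deg G v) (hne : Even n) (hδn : 6 * δ + 10 ≤ n)
    (hspec : ∀ (B : Finset V) (e : ℕ), (∀ v ∈ B, deg (closure (n - 1) G) v ≤ e) → e + 1 = #B →
      δ + 2 ≤ #B → ¬ 2 * #B ≤ n) :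
    HasFactor G 1 ∨
      (Even δ ∧ Nonempty (closure (n - 1) G ≃g
        (SimpleGraph.completeGraph (Fin (n - δ - 1)) ⊕g
          SimpleGraph.completeGraph (Fin (δ + 1))))) ∨
      Nonempty (closure (n - 1) G ≃g
        join (SimpleGraph.completeGraph (Fin δ))
          (SimpleGraph.completeGraph (Fin (n - 2 * δ - 1)) ⊕g
            SimpleGraph.emptyGraph (Fin (δ + 1)))) := by
  have hcl := closure_spec (n - 1) G
  set H := closure (n - 1) G with hH
  have hc := hcl.isClosed
  have hGH : G ≤ H := le_of_closureSteps hcl.1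
  have hδH : ∀ v, δ ≤ deg H v := fun v => (hδ v).trans (deg_mono hGH v)
  have hback : HasFactor H 1 → HasFactor G 1 :=
    HasFactor.of_reflTransGen (by omega) hcl.1
  obtain ⟨m, hm⟩ := hne
  obtain ⟨B, hB, hK⟩ := hc.exists_clique_compl (t := δ + 1) (by omega) (by omega)
    -- The condition with `l = n - 1` reads `2 * #B ≤ n + 1`; since `n` is even, this improves to `2
    -- * #B ≤ n`.
    fun B e hBe he hBδ h2 => hspec B e hBe (by omega) hBδ (by omega)
  have hl : n - 1 + (δ + 1) = Fintype.card V + δ := by omega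
  rcases hc.hasFactor_or_nearFactor hδH hl hB (by omega) hK (k := 1) (by omega)
    (by rw [mul_one, hn, hm]; exact ⟨m, rfl⟩) (by omega) with h1 | ⟨b, hb, w, hw, hbw, F, hF⟩
  · exact Or.inl (hback h1)
  obtain ⟨hBt, hdB⟩ := hc.deg_eq_of_not_adj hδH hl hB hK hb hw hbw
  have hS : ∀ z, z ∉ B → ∀ b' ∈ B, H.Adj b' z → ∀ b'' ∈ B, H.Adj b'' z :=
    fun z hz b' hb' hbz => hc.adj_of_adj hδH hl hB hK hz hb' hbz
  rcases hF.hasFactor_one_or hK (by omega) hb hw hbw (fun b' hb' => by rw [hdB b' hb', hBt]) hS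
    with h1 | h1 | ⟨h1, hev⟩
  · exact Or.inl (hback h1)
  · right; right
    have hSB : nbr H b ⊆ Bᶜ := fun z hz => mem_compl.2 fun hzB => h1 z hzB (mem_nbr.1 hz)
    -- The neighbours of `b` lie outside `B`, hence see all of `B`; equal degrees leave no others.
    have hnbr : ∀ b' ∈ B, nbr H b' = nbr H b := by
      intro b' hb'
      refine (Finset.eq_of_subset_of_card_le (fun z hz => ?_) ?_).symm
      · rw [mem_nbr] at hz ⊢
        exact hS z (fun hzB => h1 z hzB hz) b hb hz b' hb'
      · exact ((hdB b' hb').trans (hdB b hb).symm).le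
    refine nonempty_iso_join (B := B) (S := nbr H b) ?_ (hdB b hb) hBt (by omega) fun u v => ?_
    · rw [disjoint_left]
      exact fun z hz => mem_compl.1 (hSB hz)
    by_cases hu : u ∈ B <;> by_cases hv : v ∈ B
    · have e1 : H.Adj u v ↔ v ∈ nbr H b := by rw [← hnbr u hu, mem_nbr]
      have e2 : v ∉ nbr H b := fun h => mem_compl.1 (hSB h) hv
      have e3 : u ∉ nbr H b := fun h => mem_compl.1 (hSB h) hu
      tauto
    · have e1 : H.Adj u v ↔ v ∈ nbr H b := by rw [← hnbr u hu, mem_nbr]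
      have e3 : u ∉ nbr H b := fun h => mem_compl.1 (hSB h) hu
      have e4 : u ≠ v := fun h => hv (h ▸ hu)
      tauto
    · have e1 : H.Adj u v ↔ u ∈ nbr H b := by rw [← hnbr v hv, mem_nbr, H.adj_comm]
      have e3 : v ∉ nbr H b := fun h => mem_compl.1 (hSB h) hv
      have e4 : u ≠ v := fun h => hu (h ▸ hv)
      tauto
    · exact ⟨fun h => ⟨h.ne, by tauto⟩, fun h => hK u v hu hv h.1⟩
  · right; left
    rw [hdB b hb] at hev
    have hKB : ∀ u ∈ B, ∀ v, v ∉ B → ¬ H.Adj u v := fun u hu v hv huv =>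
      h1 v hv (hS v hv u hu huv b hb)
    refine ⟨hev, nonempty_iso_sum_complete (B := B) (by omega) hBt hK (fun u hu v hv huv => ?_)
      hKB⟩
    have h2 : nbr H u = B.erase u := by
      refine Finset.eq_of_subset_of_card_le (fun z hz => ?_) ?_
      · rw [mem_nbr] at hz
        exact mem_erase.2 ⟨hz.ne', by_contra fun h => hKB u hu z h hz⟩
      · rw [card_erase_of_mem hu, hBt]
        exact (hdB u hu).ge
    exact mem_nbr.1 (h2 ▸ mem_erase.2 ⟨huv.symm, hv⟩)

theorem hasFactor_of_closure {G : SimpleGraph V} {n δ k : ℕ} (hn : Fintype.card V = n)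
    (hδ : ∀ v, δ ≤ deg G v) (hk : 2 ≤ k) (hnk : Even (n * k)) (hkδ : 2 * k ≤ δ + 2)
    (hδn : 6 * δ + 4 * k ≤ n + 3)
    (hspec : ∀ (B : Finset V) (e : ℕ), (∀ v ∈ B, deg (closure (n + 2 * k - 4) G) v ≤ e) →
      e + 4 = #B + 2 * k → δ + 5 ≤ #B + 2 * k → ¬ 2 * #B + 2 * k ≤ n + 4) :
    HasFactor G k := by
  have hcl := closure_spec (n + 2 * k - 4) G
  set H := closure (n + 2 * k - 4) G with hH
  have hc := hcl.isClosed
  have hGH : G ≤ H := le_of_closureSteps hcl.1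
  have hδH : ∀ v, δ ≤ deg H v := fun v => (hδ v).trans (deg_mono hGH v)
  refine HasFactor.of_reflTransGen (by omega) hcl.1 ?_
  obtain ⟨B, hB, hK⟩ := hc.exists_clique_compl (t := δ + 4 - 2 * k) (by omega) (by omega)
    fun B e hBe he hBδ h2 => hspec B e hBe (by omega) (by omega) (by omega)
  have hl : n + 2 * k - 4 + (δ + 4 - 2 * k) = Fintype.card V + δ := by omega
  rcases hc.hasFactor_or_nearFactor hδH hl hB (by omega) hK (k := k) (by omega)
    (by rwa [hn]) (by omega) with h1 | ⟨b, hb, w, hw, hbw, F, hF⟩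
  · exact h1
  obtain ⟨hBt, hdB⟩ := hc.deg_eq_of_not_adj hδH hl hB hK hb hw hbw
  have hdb := hdB b hb
  exact hF.hasFactor_of_two_le hk hK (by omega) hb hw hbw (by omega) (by omega)
    fun z hz hbz => hc.adj_of_adj hδH hl hB hK hz hb hbz

end Main
end FactorSpectral

theorem corollary1p8 {V : Type*} [Fintype V] [DecidableEq V] (G : SimpleGraph V)
    [DecidableRel G.Adj] (n δ : ℕ) (hn : Fintype.card V = n) (hδ : δ ≤ G.minDegree) :
    (Even n → 1 ≤ δ → (δ : ℝ) ≤ (n : ℝ) / 2 - 1 → 6 * δ + 10 ≤ n →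
      ((δ : ℝ) - 1) / 2 + √((n : ℝ) ^ 2 - (3 * (δ : ℝ) + 5) * (n : ℝ)
          + (13 * (δ : ℝ) ^ 2 + 23 * (δ : ℝ) + 41) / 4) < FactorSpectral.spectralRadius G →
      FactorSpectral.HasFactor G 1 ∨
      (Even δ ∧ Nonempty (FactorSpectral.closure (n - 1) G ≃g
        (SimpleGraph.completeGraph (Fin (n - δ - 1)) ⊕g
          SimpleGraph.completeGraph (Fin (δ + 1))))) ∨
      Nonempty (FactorSpectral.closure (n - 1) G ≃g
        FactorSpectral.join (SimpleGraph.completeGraph (Fin δ))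
          (SimpleGraph.completeGraph (Fin (n - 2 * δ - 1)) ⊕g
            SimpleGraph.emptyGraph (Fin (δ + 1))))) ∧
    (∀ k : ℕ, 2 ≤ k → Even (n * k) →
      2 * (k : ℤ) - 2 ≤ (δ : ℤ) → (δ : ℤ) ≤ ⌊((n : ℝ) + 2 * (k : ℝ) - 5) / 2⌋ →
      6 * (δ : ℤ) + 4 * (k : ℤ) - 3 ≤ (n : ℤ) →
      ((δ : ℝ) - 1) / 2 + √((n : ℝ) ^ 2 - (3 * (δ : ℝ) - 4 * (k : ℝ) + 11) * (n : ℝ)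
          + (13 * (δ : ℝ) ^ 2 - (32 * (k : ℝ) - 94) * (δ : ℝ) + 16 * (k : ℝ) ^ 2
            - 104 * (k : ℝ) + 161) / 4) < FactorSpectral.spectralRadius G →
      FactorSpectral.HasFactor G k) := by
  have hdeg : ∀ v, δ ≤ FactorSpectral.deg G v := fun v => by
    rw [← FactorSpectral.degree_eq_deg]
    exact hδ.trans (G.minDegree_le_degree v)
  classical
  have bound : 0 < n → ∀ (l : ℕ) (B : Finset V) (e : ℕ),
      (∀ v ∈ B, FactorSpectral.deg (FactorSpectral.closure l G) v ≤ e) → 0 < B.card →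
      (e : ℝ) < FactorSpectral.spectralRadius G →
      0 < FactorSpectral.spectralRadius G * (FactorSpectral.spectralRadius G + 1) - e * B.card →
      (FactorSpectral.spectralRadius G + 1 - n + B.card) *
        (FactorSpectral.spectralRadius G * (FactorSpectral.spectralRadius G + 1) - e * B.card) ≤
        B.card * (e : ℝ) ^ 2 := by
    intro hn0 l B e hB hB0 he hpos
    have : Nonempty V := Fintype.card_pos_iff.1 (by omega)
    obtain ⟨x, hx, hx0, hsub⟩ := FactorSpectral.exists_subeigenvector G
    have hGH := FactorSpectral.le_of_closureSteps (FactorSpectral.closure_spec l G).1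
    rw [← hn]
    exact FactorSpectral.subeigenvector_bound (FactorSpectral.closure l G) hx hx0
      (FactorSpectral.subeigenvector_mono hGH hx hsub)
      (fun v hv => (FactorSpectral.degree_eq_deg _ v).trans_le (hB v hv))
      (Finset.card_pos.1 hB0) he hpos
  refine ⟨fun hne h1δ _ hδn hρ => ?_, fun k hk hnk hkδ _ hδn hρ => ?_⟩
  · refine FactorSpectral.hasFactor_one_or_of_closure hn hdeg hne hδn fun B e hB he hBδ hBn => ?_
    have heR : (e : ℝ) = B.card - 1 := by rw [← he]; push_cast; ring
    obtain ⟨h1, h2, h3⟩ := FactorSpectral.spectral_estimate_matching (n := n) (δ := δ)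
      (b := B.card) (by exact_mod_cast h1δ) (by exact_mod_cast hδn) (by exact_mod_cast hBδ)
      (by exact_mod_cast hBn) hρ
    rw [← heR] at h1 h2 h3
    exact absurd (bound (by omega) (n - 1) B e hB (by omega) h1 h2) (not_le.2 h3)
  · refine FactorSpectral.hasFactor_of_closure hn hdeg hk hnk (by omega) (by omega)
      fun B e hB he hBδ hBn => ?_
    have heR : (e : ℝ) = B.card + (2 * k - 4) := by
      have : (e : ℝ) + 4 = B.card + 2 * k := by exact_mod_cast he
      linarith
    have c1 : (δ : ℝ) + 5 ≤ B.card + 2 * k := by exact_mod_cast hBδ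
    have c2 : 2 * (B.card : ℝ) + 2 * k ≤ n + 4 := by exact_mod_cast hBn
    have c3 : 6 * (δ : ℝ) + 4 * k - 3 ≤ n := by exact_mod_cast hδn
    have c4 : 2 * (k : ℝ) - 2 ≤ δ := by exact_mod_cast hkδ
    obtain ⟨h1, h2, h3⟩ := FactorSpectral.spectral_estimate_factor (n := n) (δ := δ) (k := k)
      (b := B.card) (by exact_mod_cast hk) c4 c3 (by linarith) (by linarith) hρ
    rw [← heR] at h1 h2 h3
    exact absurd (bound (by omega) _ B e hB (by omega) h1 h2) (not_le.2 h3)
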